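/- **Setting.** Let $A\in\mathbb R^{n\times n}$ be symmetric positive definite and $0\ne b\in\mathbb R^n$. The backward error of $x$ is $\mathrm{berr}_{A,b}(x)=\inf\{\|\Delta\|_2/\|A\|_2 : (A+\Delta)x=b\}$ (so $\mathrm{berr}_{A,b}(0)=\infty$), and $\mathcal K_k(A,b)=\mathrm{span}\{b,Ab,\dots,A^{k-1}b\}$. **Algorithm (MINBERR).** Input: $A,b$, an iteration limit $k_{\max}\ge1$, a tolerance $\epsilon\ge0$, a failure probability $\delta\in(0,1)$. 1. Set $q_1=b/\|b\|_2$, $q_0=0$, $\beta_1=1$. For $k=1,2,\dots,k_{\max}$: do the Lanczos step $\hat w_k=Aq_k-\beta_kq_{k-1}$, $\alpha_k=\hat w_k^\top q_k$, $w_k=\hat w_k-\alpha_kq_k$, $\beta_{k+1}=\|w_k\|_2$, $q_{k+1}=w_k/\beta_{k+1}$. Let $T_k$ be the $(k+1)\times k$ tridiagonal matrix with $(T_k)_{i,i}=\alpha_i$, $(T_k)_{i,i+1}=(T_k)_{i+1,i}=\beta_{i+1}$, and let $\tilde T_k$ be the $k\times k$ upper triangular matrix obtained by removing its first row. Append the last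 column of the Cholesky factor of $\tilde T_k^\top\tilde T_k-\epsilon^2I_k$; if the factorization breaks down (nonpositive pivot), leave the loop. 2. Let $k$ be the number of steps made. If $\beta_{k+1}\neq0$: let $v\in\mathbb R^k$ have independent standard Gaussian entries, and starting with $\ell=0$, while $\ell<2.23\ln(k/\delta^2)$ solve $\tilde T_k^\top z=v$ and $\tilde T_kv=z$ by substitution, normalize $v:=v/\|v\|_2$, and set $\ell:=\ell+1$. If $\beta_{k+1}=0$ (then $\tilde T_k$ is singular and $\mathcal K_k(A,b)$ contains the exact solution): let $v$ be the solution of $\tilde T_kv=0$ with last entry $1$, found by substitution. 3. Return $\hat x_k=\frac1\alpha\sum_{j=1}^kv_jq_j$ with $\alpha=\frac1{\|b\|_2}\big((T_k)_{1,1}v_1+(T_k)_{1,2}v_2\big)$ (the second term is absent if $k=1$). **Model of computation.** Exact real arithmetic. Each $+,-,\times,\div,\sqrt{\cdot},\ln$, comparison of reals and Gaussian draw is one operation, and each product of $A$ with a vector is $\mathcal T_A$ operations; indexing, copying and the control of loops over index ranges are free. **Theorem.** There is an absolute constant $C$ such that for all $n,A,b,k_{\max},\epsilon,\delta$ as above the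 following holds. The number $k$ of steps made, $1\le k\le k_{\max}$, does not depend on the random draws, and either $k=k_{\max}$ or some $x\in\mathcal K_k(A,b)$ has $\|A\|_2\,\mathrm{berr}_{A,b}(x)\le\epsilon$. The minimum of $\mathrm{berr}_{A,b}$ over $\mathcal K_k(A,b)$ is attained, and with probability at least $1-\delta$ $$\mathrm{berr}_{A,b}(\hat x_k)\le\Big(1+\frac12\Big)\min_{x\in\mathcal K_k(A,b)}\mathrm{berr}_{A,b}(x).$$ For every outcome of the random draws and every $\mathcal T_A\in\mathbb N$, the run takes at most $C\,k\,\big(\mathcal T_A+n+\log(1/\delta)\big)$ operations. -/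

import Mathlib

open MeasureTheory ProbabilityTheory
open scoped ENNReal

noncomputable section

namespace Minberr

/-! ## Backward error and Krylov subspaces -/

/-- The spectral norm of a square real matrix (operator norm for the Euclidean norm). -/
def specNorm {n : ℕ} (M : Matrix (Fin n) (Fin n) ℝ) : ℝ :=
  ‖Matrix.toEuclideanCLM (n := Fin n) (𝕜 := ℝ) M‖

/-- Backward error of `x` for the system `A x = b`: the infimum of `‖Δ‖₂ / ‖A‖₂` over all `Δ`
with `(A + Δ) x = b`. It is `∞` if there is no such `Δ`, that is, if `x = 0` and `b ≠ 0`. -/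
def berr {n : ℕ} (A : Matrix (Fin n) (Fin n) ℝ) (b x : Fin n → ℝ) : ℝ≥0∞ :=
  ⨅ (D : Matrix (Fin n) (Fin n) ℝ) (_ : (A + D).mulVec x = b),
    ENNReal.ofReal (specNorm D / specNorm A)

/-- The Krylov subspace `span {b, A b, …, A ^ (k - 1) b}`. -/
def krylov {n : ℕ} (A : Matrix (Fin n) (Fin n) ℝ) (b : Fin n → ℝ) (k : ℕ) :
    Submodule ℝ (Fin n → ℝ) :=
  Submodule.span ℝ (Set.range fun i : Fin k => (A ^ (i : ℕ)).mulVec b)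

/-! ## Model of computation: exact real arithmetic with a matrix-vector product oracle -/

inductive BinOp where
  | add | sub | mul | div

inductive UnOp where
  | sqrt | ln

def BinOp.eval : BinOp → ℝ → ℝ → ℝ
  | .add, x, y => x + y
  | .sub, x, y => x - y
  | .mul, x, y => x * y
  | .div, x, y => x / y

def UnOp.eval : UnOp → ℝ → ℝ
  | .sqrt, x => Real.sqrt x
  | .ln, x => Real.log x

/-- Programs over the reals that return a value in `α`. Besides returning, the instructions are:
a binary or a unary arithmetic operation, a comparison `x < y`, drawing a standard Gaussian, and
multiplying a vector by the (hidden) `n × n` matrix. The rest of the program receives the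
result of the instruction. -/
inductive Prog (n : ℕ) (α : Type) : Type where
  | ret (a : α) : Prog n α
  | bin (o : BinOp) (x y : ℝ) (next : ℝ → Prog n α) : Prog n α
  | un (o : UnOp) (x : ℝ) (next : ℝ → Prog n α) : Prog n α
  | less (x y : ℝ) (next : Bool → Prog n α) : Prog n α
  | gauss (next : ℝ → Prog n α) : Prog n α
  | matvec (x : Fin n → ℝ) (next : (Fin n → ℝ) → Prog n α) : Prog n α

namespace Prog

/-- Sequential composition. -/
def bind {n : ℕ} {α β : Type} : Prog n α → (α → Prog n β) → Prog n β
  | .ret a, f => f a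
  | .bin o x y next, f => .bin o x y fun r => (next r).bind f
  | .un o x next, f => .un o x fun r => (next r).bind f
  | .less x y next, f => .less x y fun r => (next r).bind f
  | .gauss next, f => .gauss fun r => (next r).bind f
  | .matvec x next, f => .matvec x fun r => (next r).bind f

instance {n : ℕ} : Monad (Prog n) where
  pure := Prog.ret
  bind := Prog.bind

open Classical in
/-- Run a program with matrix `A`, the successive Gaussian draws being read from the sequence
`ω`. The result is the returned value with the number of operations: each arithmetic operation,
comparison and Gaussian draw counts `1`, and each product of `A` with a vector counts `TA`. -/
def exec {n : ℕ} {α : Type} (A : Matrix (Fin n) (Fin n) ℝ) (TA : ℕ) :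
    Prog n α → (ℕ → ℝ) → α × ℕ
  | .ret a, _ => (a, 0)
  | .bin o x y next, ω =>
      let r := exec A TA (next (o.eval x y)) ω
      (r.1, r.2 + 1)
  | .un o x next, ω =>
      let r := exec A TA (next (o.eval x)) ω
      (r.1, r.2 + 1)
  | .less x y next, ω =>
      let r := exec A TA (next (decide (x < y))) ω
      (r.1, r.2 + 1)
  | .gauss next, ω =>
      let r := exec A TA (next (ω 0)) (fun i => ω (i + 1))
      (r.1, r.2 + 1)
  | .matvec x next, ω =>
      let r := exec A TA (next (A.mulVec x)) ω
      (r.1, r.2 + TA)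

/-! Single instructions as programs. -/

def addP {n : ℕ} (x y : ℝ) : Prog n ℝ := .bin .add x y .ret
def subP {n : ℕ} (x y : ℝ) : Prog n ℝ := .bin .sub x y .ret
def mulP {n : ℕ} (x y : ℝ) : Prog n ℝ := .bin .mul x y .ret
def divP {n : ℕ} (x y : ℝ) : Prog n ℝ := .bin .div x y .ret
def sqrtP {n : ℕ} (x : ℝ) : Prog n ℝ := .un .sqrt x .ret
def lnP {n : ℕ} (x : ℝ) : Prog n ℝ := .un .ln x .ret
def lessP {n : ℕ} (x y : ℝ) : Prog n Bool := .less x y .ret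
def gaussP {n : ℕ} : Prog n ℝ := .gauss .ret
def matvecP {n : ℕ} (x : Fin n → ℝ) : Prog n (Fin n → ℝ) := .matvec x .ret

/-! Loops over vectors. -/

/-- Compute the entries `f 0, …, f (m - 1)` of a vector one after another. -/
def vecP {n : ℕ} : (m : ℕ) → (Fin m → Prog n ℝ) → Prog n (Fin m → ℝ)
  | 0, _ => pure Fin.elim0
  | m + 1, f => do
      let x ← f 0
      let xs ← vecP m fun i => f i.succ
      pure (Fin.cons x xs)

/-- Compute the sum of `f 0, …, f (m - 1)`. -/
def sumP {n : ℕ} : (m : ℕ) → (Fin m → Prog n ℝ) → Prog n ℝ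
  | 0, _ => pure 0
  | m + 1, f => do
      let s ← sumP m fun i => f i.castSucc
      let x ← f (Fin.last m)
      addP s x

/-- Compute `f 1, …, f k` and store them at the indices `1, …, k` of an array of zeros. -/
def arrayP {n : ℕ} (f : ℕ → Prog n ℝ) : ℕ → Prog n (ℕ → ℝ)
  | 0 => pure fun _ => 0
  | k + 1 => do
      let v ← arrayP f k
      let x ← f (k + 1)
      pure (Function.update v (k + 1) x)

def dotP {n m : ℕ} (x y : Fin m → ℝ) : Prog n ℝ :=
  sumP m fun i => mulP (x i) (y i)

def normP {n m : ℕ} (x : Fin m → ℝ) : Prog n ℝ := do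
  let s ← dotP x x
  sqrtP s

end Prog

open Prog

/-! ## The algorithm

All sequences are indexed from `1`; `T` is the `(k + 1) × k` Lanczos matrix with
`T i i = α i`, `T i (i + 1) = T (i + 1) i = β (i + 1)`, and `T'` is the `k × k` matrix obtained
from `T` by removing its first row. So `T'` is upper triangular with three nonzero diagonals. -/

/-- The memory of the main loop. -/
structure State (n : ℕ) where
  /-- the Lanczos vectors `q 1, q 2, …` (and `q 0 = 0`) -/
  q : ℕ → Fin n → ℝ
  α : ℕ → ℝ
  β : ℕ → ℝ
  /-- the diagonal `d j = T' j j = β (j + 1)` -/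
  d : ℕ → ℝ
  /-- the first superdiagonal `e j = T' (j - 1) j = α j` for `2 ≤ j` (and `e 1 = 0`) -/
  e : ℕ → ℝ
  /-- the second superdiagonal `f j = T' (j - 2) j = β j` for `3 ≤ j` (and `f 1 = f 2 = 0`) -/
  f : ℕ → ℝ
  /-- the entries `R j j` of the Cholesky factor (and `R 0 0 = 1` as a dummy) -/
  r0 : ℕ → ℝ
  /-- the entries `R (j - 1) j` of the Cholesky factor -/
  r1 : ℕ → ℝ

/-- The memory before the first step: `q 1 = b / ‖b‖`, `q 0 = 0`, `β 1 = 1`. -/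
def initState {n : ℕ} (q1 : Fin n → ℝ) : State n where
  q := Function.update (fun _ _ => 0) 1 q1
  α := fun _ => 0
  β := Function.update (fun _ => 0) 1 1
  d := fun _ => 0
  e := fun _ => 0
  f := fun _ => 0
  r0 := Function.update (fun _ => 0) 0 1
  r1 := fun _ => 0

/-- The `k`-th Lanczos step, which also appends the last column of `T'`.
(If `β (k + 1) = 0` then `q (k + 1)` is never used: the main loop stops.) -/
def lanczosStep {n : ℕ} (k : ℕ) (s : State n) : Prog n (State n) := do
  let y ← matvecP (s.q k)
  let wh ← vecP n fun i => do
    let p ← mulP (s.β k) (s.q (k - 1) i)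
    subP (y i) p
  let a ← dotP wh (s.q k)
  let w ← vecP n fun i => do
    let p ← mulP a (s.q k i)
    subP (wh i) p
  let c ← normP w
  let q' ← vecP n fun i => divP (w i) c
  pure { s with
    q := Function.update s.q (k + 1) q'
    α := Function.update s.α k a
    β := Function.update s.β (k + 1) c
    d := Function.update s.d k c
    e := Function.update s.e k (if 2 ≤ k then a else 0)
    f := Function.update s.f k (if 3 ≤ k then s.β k else 0) }

/-- Compute the last column of `G = T'ᵀ T'`, then the last column of the Cholesky
factor `R` of `G - ε² I`. The result is `false` if the factorization breaks down, that is, if the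
number whose square root would be `R k k` is not positive. -/
def choleskyStep {n : ℕ} (ε : ℝ) (k : ℕ) (s : State n) : Prog n (State n × Bool) := do
  -- the entry `G (k - 2) k`
  let g2 ← mulP (s.d (k - 2)) (s.f k)
  -- the entry `G (k - 1) k`
  let u ← mulP (s.d (k - 1)) (s.e k)
  let v ← mulP (s.e (k - 1)) (s.f k)
  let g1 ← addP u v
  -- the entry `G k k`
  let d2 ← mulP (s.d k) (s.d k)
  let e2 ← mulP (s.e k) (s.e k)
  let f2 ← mulP (s.f k) (s.f k)
  let de ← addP d2 e2
  let g0 ← addP de f2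
  -- the entries `R (k - 2) k` and `R (k - 1) k`
  let r2 ← divP g2 (s.r0 (k - 2))
  let p ← mulP (s.r1 (k - 1)) r2
  let h ← subP g1 p
  let r1 ← divP h (s.r0 (k - 1))
  -- the square of `R k k`
  let ee ← mulP ε ε
  let t ← subP g0 ee
  let r11 ← mulP r1 r1
  let r22 ← mulP r2 r2
  let t' ← subP t r11
  let pivot ← subP t' r22
  let ok ← lessP 0 pivot
  if ok then
    let r0 ← sqrtP pivot
    pure ({ s with
      r0 := Function.update s.r0 k r0
      r1 := Function.update s.r1 k r1 }, true)
  else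
    pure (s, false)

/-- The main loop, `m` being the number of steps still allowed and `k` the number of steps
already made. The result is the total number of steps with the memory. -/
def mainLoop {n : ℕ} (ε : ℝ) : (m k : ℕ) → State n → Prog n (ℕ × State n)
  | 0, k, s => pure (k, s)
  | m + 1, k, s => do
      let s ← lanczosStep (k + 1) s
      let c ← choleskyStep ε (k + 1) s
      if c.2 then mainLoop ε m (k + 1) c.1 else pure (k + 1, c.1)

/-- Forward substitution for the `k × k` system `T'ᵀ z = v`. -/
def solveTranspose {n : ℕ} (s : State n) (v : ℕ → ℝ) : (k : ℕ) → Prog n (ℕ → ℝ)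
  | 0 => pure fun _ => 0
  | i + 1 => do
      let z ← solveTranspose s v i
      let p ← mulP (s.e (i + 1)) (z i)
      let p' ← mulP (s.f (i + 1)) (z (i - 1))
      let r ← subP (v (i + 1)) p
      let r' ← subP r p'
      let x ← divP r' (s.d (i + 1))
      pure (Function.update z (i + 1) x)

/-- Back substitution for `T' v = z`: compute `v i, …, v 1` in this order from equations
number `i, …, 1`, where the entries of `v` at larger indices are already there. -/
def solveUpper {n : ℕ} (s : State n) (z : ℕ → ℝ) : (i : ℕ) → (ℕ → ℝ) → Prog n (ℕ → ℝ)
  | 0, v => pure v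
  | i + 1, v => do
      let p ← mulP (s.e (i + 2)) (v (i + 2))
      let p' ← mulP (s.f (i + 3)) (v (i + 3))
      let r ← subP (z (i + 1)) p
      let r' ← subP r p'
      let x ← divP r' (s.d (i + 1))
      solveUpper s z i (Function.update v (i + 1) x)

/-- One step of normalized inverse iteration with the `k × k` matrix `T'ᵀ T'`. -/
def inverseStep {n : ℕ} (s : State n) (k : ℕ) (v : ℕ → ℝ) : Prog n (ℕ → ℝ) := do
  let z ← solveTranspose s v k
  let y ← solveUpper s z k fun _ => 0
  let c ← normP fun i : Fin k => y (i + 1)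
  arrayP (fun i => divP (y i) c) k

/-- The loop `while ℓ < thr`: one step of inverse iteration, then `ℓ := ℓ + 1`. The first
argument bounds the number of passes; `⌈thr⌉₊` passes are enough when `ℓ` starts at `0`. -/
def inverseLoop {n : ℕ} (s : State n) (k : ℕ) (thr : ℝ) :
    (m : ℕ) → (ℓ : ℝ) → (ℕ → ℝ) → Prog n (ℕ → ℝ)
  | 0, _, v => pure v
  | m + 1, ℓ, v => do
      let go ← lessP ℓ thr
      if go then
        let v ← inverseStep s k v
        let ℓ ← addP ℓ 1
        inverseLoop s k thr m ℓ v
      else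
        pure v

/-- Approximate smallest right singular vector of `T'`. If `T'` is nonsingular:
inverse iteration from a Gaussian vector, while `ℓ < 2.23 ln (k / δ²)`. If `T'` is singular, which
happens exactly when `β (k + 1) = 0`: the null vector with last entry `1`. -/
def singularVector {n : ℕ} (δ : ℝ) (k : ℕ) (s : State n) : Prog n (ℕ → ℝ) := do
  let regular ← lessP 0 (s.d k)
  if regular then
    let v ← arrayP (fun _ => gaussP) k
    let d2 ← mulP δ δ
    let t ← divP k d2
    let l ← lnP t
    let thr ← mulP 2.23 l
    inverseLoop s k thr ⌈thr⌉₊ 0 v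
  else
    solveUpper s (fun _ => 0) (k - 1) (Function.update (fun _ => 0) k 1)

structure Output (n : ℕ) where
  /-- the number `k` of Lanczos steps made -/
  steps : ℕ
  /-- the approximate solution -/
  x : Fin n → ℝ

/-- MINBERR for `A x = b` with at most `kmax` steps, tolerance `ε`, failure probability `δ`. -/
def minberr {n : ℕ} (b : Fin n → ℝ) (kmax : ℕ) (ε δ : ℝ) : Prog n (Output n) := do
  let nb ← normP b
  let q1 ← vecP n fun i => divP (b i) nb
  let r ← mainLoop ε kmax 0 (initState q1)
  let k := r.1
  let s := r.2
  let v ← singularVector δ k s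
  -- the scalar `a = (T 1 1 * v 1 + T 1 2 * v 2) / ‖b‖`, where `v 2 = 0` if `k = 1`
  let p ← mulP (s.α 1) (v 1)
  let p' ← mulP (s.β 2) (v 2)
  let t ← addP p p'
  let a ← divP t nb
  -- the vector `x = (1 / a) * ∑ j, v j * q j`
  let x ← vecP n fun i => do
    let c ← sumP k fun j : Fin k => mulP (v (j + 1)) (s.q (j + 1) i)
    divP c a
  pure { steps := k, x := x }

end Minberr

end

/-!
The minimal backward error over a Krylov subspace is a smallest singular value. Write `x = Q z`
with the Lanczos vectors as columns of `Q`, and let `T` be the `(k + 1) × k` Lanczos matrix and `T'`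
the matrix `T` without its first row. A rank one perturbation shows that
`berr A b x = ‖b - A x‖ / (‖x‖ ‖A‖)` (`berr_eq`), and since `A Q = Q⁺ T` with `Q⁺` orthonormal and
`b = ‖b‖ q 1`, the squared residual is `(‖b‖ - (T z) 1) ^ 2 + ‖T' z‖ ^ 2`
(`IsLanczos.residual_sq`). Whenever `(T z) 1 ≠ 0`, the scaling of `z` used by the algorithm makes
the first square vanish, and the backward error is then `‖T' z‖ / (‖z‖ ‖A‖)`; for every `z` it is
at least that. So the minimum is `σ / ‖A‖` with `σ` the smallest singular value of `T'`, as soon as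
some right singular vector for `σ` has `(T z) 1 ≠ 0`.

Such a vector exists because `A` is positive definite: the compression `Qᵀ A Q` is then positive
definite and tridiagonal with positive off-diagonal entries, which forces the inverse of `T'` to
have the checkerboard sign pattern (`IsLanczos.alternating`). As in Perron's theorem, making the
signs of `T' z` alternate keeps `‖T' z‖`, does not decrease `‖z‖`, and yields a vector with
`(T z) 1 ≠ 0` (`IsLanczos.exists_firstRow_ne_zero`). If `β (k + 1) = 0` then the same sign argument
applies to the null vector of `T'`, and the output is an exact solution.

The Cholesky pivots come from completing squares in `‖T' z‖ ^ 2 - ε ^ 2 ‖z‖ ^ 2`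
(`IsChol.sum_mul_sq`): a nonpositive pivot gives `z` with `‖T' z‖ ≤ ε ‖z‖`, so the tolerance is met,
and a positive pivot makes `T'` nonsingular, so the Lanczos process can go on.

Inverse iteration from a Gaussian vector `g` yields a multiple of `w = (T'ᵀ T')⁻ᴺ g`. In an
eigenbasis of `T'ᵀ T'`, the inequality `‖T' w‖ ≤ 3 / 2 * σ * ‖w‖` holds as soon as
`decay N * ‖g‖ ^ 2 ≤ 5 / 4 * ⟪u, g⟫ ^ 2`, with `u` a unit singular vector for `σ`
(`exists_smallest_singular`). Here `⟪u, g⟫` is standard normal, so `|⟪u, g⟫| ≤ δ` has probability at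
most `4 / 5 * δ`; by Markov's inequality `‖g‖ ^ 2 ≥ 5 k / δ` has probability at most `δ / 5`; and
`(T w) 1` is a nonzero linear functional of `g`, hence almost surely nonzero
(`le_measure_of_good_start`). The number of passes makes `decay N` small enough (`decay_le`).

Programs are handled through the relations `Prog.Runs` and `Prog.Det`, which describe the result
and bound the number of operations compositionally. The dimension bounds `k`, because the Lanczos
vectors are orthonormal, so the `log k` in the number of passes is absorbed by `n`.
-/

noncomputable section

namespace Minberr

/-! ### Executing programs -/

namespace Prog

variable {n : ℕ}

theorem bind_assoc {α β γ : Type} (p : Prog n α) (f : α → Prog n β) (g : β → Prog n γ) :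
    (p.bind f).bind g = p.bind fun a => (f a).bind g := by
  induction p with
  | ret a => rfl
  | bin o x y next ih => simp only [bind, ih]
  | un o x next ih => simp only [bind, ih]
  | less x y next ih => simp only [bind, ih]
  | gauss next ih => simp only [bind, ih]
  | matvec x next ih => simp only [bind, ih]

theorem bind_ret {α : Type} (p : Prog n α) : p.bind ret = p := by
  induction p with
  | ret a => rfl
  | bin o x y next ih => simp only [bind, ih]
  | un o x next ih => simp only [bind, ih]
  | less x y next ih => simp only [bind, ih]
  | gauss next ih => simp only [bind, ih]
  | matvec x next ih => simp only [bind, ih]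

/-- `Runs A TA p ω a c ω'`: reading Gaussian draws from `ω`, the program `p` returns `a` after at
most `c` operations and leaves the draws `ω'` unread. This is phrased through the continuations of
`p`, which makes it compositional without an evaluator that returns the unread draws. -/
def Runs {α : Type} (A : Matrix (Fin n) (Fin n) ℝ) (TA : ℕ) (p : Prog n α) (ω : ℕ → ℝ)
    (a : α) (c : ℕ) (ω' : ℕ → ℝ) : Prop :=
  ∀ (β : Type) (f : α → Prog n β),
    (exec A TA (p.bind f) ω).1 = (exec A TA (f a) ω').1 ∧
    (exec A TA (p.bind f) ω).2 ≤ (exec A TA (f a) ω').2 + c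

/-- The program `p` draws nothing and returns `a` after at most `c` operations. -/
def Det {α : Type} (A : Matrix (Fin n) (Fin n) ℝ) (TA : ℕ) (p : Prog n α) (a : α) (c : ℕ) :
    Prop :=
  ∀ ω, Runs A TA p ω a c ω

variable {A : Matrix (Fin n) (Fin n) ℝ} {TA : ℕ} {α β : Type}

theorem Runs.exec_eq {p : Prog n α} {ω ω' : ℕ → ℝ} {a : α} {c : ℕ} (h : Runs A TA p ω a c ω') :
    (exec A TA p ω).1 = a ∧ (exec A TA p ω).2 ≤ c := by
  have := h α ret
  rw [bind_ret] at this
  simpa [exec] using this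

theorem Runs.bind {p : Prog n α} {f : α → Prog n β} {ω ω' ω'' : ℕ → ℝ} {a : α} {b : β}
    {c c' : ℕ} (hp : Runs A TA p ω a c ω') (hf : Runs A TA (f a) ω' b c' ω'') :
    Runs A TA (p >>= f) ω b (c + c') ω'' := by
  intro γ g
  have h1 := hp γ fun x => (f x).bind g
  have h2 := hf γ g
  change (exec A TA ((p.bind f).bind g) ω).1 = _ ∧ (exec A TA ((p.bind f).bind g) ω).2 ≤ _
  rw [bind_assoc]
  exact ⟨h1.1.trans h2.1, by omega⟩

theorem Det.bind {p : Prog n α} {f : α → Prog n β} {a : α} {b : β} {c c' : ℕ}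
    (hp : Det A TA p a c) (hf : Det A TA (f a) b c') : Det A TA (p >>= f) b (c + c') :=
  fun ω => (hp ω).bind (hf ω)

theorem Runs.mono {p : Prog n α} {ω ω' : ℕ → ℝ} {a : α} {c c' : ℕ} (h : Runs A TA p ω a c ω')
    (hc : c ≤ c') : Runs A TA p ω a c' ω' :=
  fun β f => ⟨(h β f).1, (h β f).2.trans (by omega)⟩

theorem Det.mono {p : Prog n α} {a : α} {c c' : ℕ} (h : Det A TA p a c) (hc : c ≤ c') :
    Det A TA p a c' :=
  fun ω => (h ω).mono hc

theorem det_pure (a : α) : Det A TA (pure a : Prog n α) a 0 :=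
  fun _ _ _ => ⟨rfl, le_rfl⟩

theorem det_addP (x y : ℝ) : Det A TA (addP x y) (x + y) 1 := fun _ _ _ => ⟨rfl, le_rfl⟩
theorem det_subP (x y : ℝ) : Det A TA (subP x y) (x - y) 1 := fun _ _ _ => ⟨rfl, le_rfl⟩
theorem det_mulP (x y : ℝ) : Det A TA (mulP x y) (x * y) 1 := fun _ _ _ => ⟨rfl, le_rfl⟩
theorem det_divP (x y : ℝ) : Det A TA (divP x y) (x / y) 1 := fun _ _ _ => ⟨rfl, le_rfl⟩
theorem det_sqrtP (x : ℝ) : Det A TA (sqrtP x) (Real.sqrt x) 1 := fun _ _ _ => ⟨rfl, le_rfl⟩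
theorem det_lnP (x : ℝ) : Det A TA (lnP x) (Real.log x) 1 := fun _ _ _ => ⟨rfl, le_rfl⟩

open Classical in
theorem det_lessP (x y : ℝ) : Det A TA (lessP x y) (decide (x < y)) 1 :=
  fun _ _ _ => ⟨rfl, le_rfl⟩

theorem det_matvecP (x : Fin n → ℝ) : Det A TA (matvecP x) (A.mulVec x) TA :=
  fun _ _ _ => ⟨rfl, le_rfl⟩

theorem runs_gaussP (ω : ℕ → ℝ) : Runs A TA gaussP ω (ω 0) 1 fun i => ω (i + 1) :=
  fun _ _ => ⟨rfl, le_rfl⟩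

theorem Det.ite {P : Prop} [Decidable P] {p q : Prog n α} {a b : α} {c : ℕ}
    (hp : P → Det A TA p a c) (hq : ¬P → Det A TA q b c) :
    Det A TA (if decide P = true then p else q) (if P then a else b) c := by
  by_cases h : P
  · rw [if_pos (decide_eq_true h), if_pos h]; exact hp h
  · rw [if_neg (by simpa using h), if_neg h]; exact hq h

theorem det_vecP {m : ℕ} {f : Fin m → Prog n ℝ} {g : Fin m → ℝ} {c : ℕ}
    (h : ∀ i, Det A TA (f i) (g i) c) : Det A TA (vecP m f) g (m * c) := by
  induction m with
  | zero =>
    have : g = Fin.elim0 := Subsingleton.elim _ _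
    rw [this, zero_mul]
    exact det_pure _
  | succ m ih =>
    refine Det.mono ((h 0).bind <| (ih (g := fun i => g i.succ) fun i => h i.succ).bind ?_)
      (c' := (m + 1) * c) (c := c + (m * c + 0)) (by rw [add_mul]; omega)
    have : Fin.cons (g 0) (fun i => g (Fin.succ i)) = g := Fin.cons_self_tail g
    rw [this]
    exact det_pure _

theorem det_sumP {m : ℕ} {f : Fin m → Prog n ℝ} {g : Fin m → ℝ} {c : ℕ}
    (h : ∀ i, Det A TA (f i) (g i) c) : Det A TA (sumP m f) (∑ i, g i) (m * (c + 1)) := by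
  induction m with
  | zero =>
    rw [Finset.univ_eq_empty, Finset.sum_empty, zero_mul]
    exact det_pure 0
  | succ m ih =>
    rw [Fin.sum_univ_castSucc]
    refine Det.mono ((ih fun i => h i.castSucc).bind <| (h (Fin.last m)).bind (det_addP _ _)) ?_
    rw [add_mul]; omega

theorem det_dotP {m : ℕ} (x y : Fin m → ℝ) : Det A TA (dotP x y) (x ⬝ᵥ y) (2 * m) :=
  (det_sumP fun i => det_mulP (x i) (y i)).mono (by omega)

theorem det_normP {m : ℕ} (x : Fin m → ℝ) :
    Det A TA (normP x) (Real.sqrt (x ⬝ᵥ x)) (2 * m + 1) :=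
  (det_dotP x x).bind (det_sqrtP _)

/-- The array holding `g 1, …, g k` at the indices `1, …, k` and `0` elsewhere. -/
def trunc (k : ℕ) (g : ℕ → ℝ) : ℕ → ℝ := fun i => if 1 ≤ i ∧ i ≤ k then g i else 0

theorem trunc_zero (g : ℕ → ℝ) : trunc 0 g = fun _ => 0 := by
  funext i; simp only [trunc]; rw [if_neg]; omega

theorem update_trunc (k : ℕ) (g : ℕ → ℝ) :
    Function.update (trunc k g) (k + 1) (g (k + 1)) = trunc (k + 1) g := by
  funext i
  by_cases h : i = k + 1
  · subst h; simp [trunc]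
  · rw [Function.update_of_ne h]
    have : (1 ≤ i ∧ i ≤ k) ↔ (1 ≤ i ∧ i ≤ k + 1) := by omega
    simp only [trunc, this]

theorem det_arrayP {f : ℕ → Prog n ℝ} {g : ℕ → ℝ} {c : ℕ} (h : ∀ i, Det A TA (f i) (g i) c)
    (k : ℕ) : Det A TA (arrayP f k) (trunc k g) (k * c) := by
  induction k with
  | zero => rw [trunc_zero, zero_mul]; exact det_pure _
  | succ k ih =>
    refine Det.mono (ih.bind <| (h (k + 1)).bind (c' := 0) ?_) (by rw [add_mul]; omega)
    rw [update_trunc]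
    exact det_pure _

theorem runs_arrayP_gaussP (ω : ℕ → ℝ) (k : ℕ) :
    Runs A TA (arrayP (fun _ => gaussP) k) ω (trunc k fun i => ω (i - 1)) k
      fun i => ω (i + k) := by
  induction k with
  | zero => rw [trunc_zero]; exact det_pure _ ω
  | succ k ih =>
    refine Runs.mono (ih.bind <| (runs_gaussP _).bind (c' := 0) ?_) le_rfl
    have h := update_trunc k fun i => ω (i - 1)
    simp only [Nat.add_sub_cancel, zero_add] at h ⊢
    rw [h]
    have e : (fun i => ω (i + 1 + k)) = fun i => ω (i + (k + 1)) := by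
      funext i; congr 1; omega
    rw [e]
    exact det_pure _ _

end Prog

/-! ### The backward error in terms of the residual -/

section

/-- The Euclidean norm of a coordinate vector. -/
def euclNorm {m : ℕ} (x : Fin m → ℝ) : ℝ := Real.sqrt (x ⬝ᵥ x)

theorem euclNorm_eq_norm {m : ℕ} (x : Fin m → ℝ) : euclNorm x = ‖WithLp.toLp 2 x‖ := by
  rw [euclNorm, EuclideanSpace.norm_eq]
  congr 1
  simp [dotProduct, pow_two]

theorem euclNorm_nonneg {m : ℕ} (x : Fin m → ℝ) : 0 ≤ euclNorm x := Real.sqrt_nonneg _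

theorem dotProduct_self_nonneg_real {m : ℕ} (x : Fin m → ℝ) : 0 ≤ x ⬝ᵥ x :=
  Finset.sum_nonneg fun i _ => mul_self_nonneg (x i)

theorem euclNorm_sq {m : ℕ} (x : Fin m → ℝ) : euclNorm x ^ 2 = x ⬝ᵥ x :=
  Real.sq_sqrt (dotProduct_self_nonneg_real x)

theorem euclNorm_pos {m : ℕ} {x : Fin m → ℝ} (hx : x ≠ 0) : 0 < euclNorm x :=
  Real.sqrt_pos.2 <| (dotProduct_self_nonneg_real x).lt_of_ne' fun h =>
    hx (dotProduct_self_eq_zero.1 h)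

variable {n : ℕ}

theorem euclNorm_mulVec_le (D : Matrix (Fin n) (Fin n) ℝ) (x : Fin n → ℝ) :
    euclNorm (D.mulVec x) ≤ specNorm D * euclNorm x := by
  rw [euclNorm_eq_norm, euclNorm_eq_norm, ← Matrix.toEuclideanCLM_toLp]
  exact ContinuousLinearMap.le_opNorm _ _

theorem specNorm_vecMulVec_le (r x : Fin n → ℝ) :
    specNorm (Matrix.vecMulVec r x) ≤ euclNorm r * euclNorm x := by
  refine ContinuousLinearMap.opNorm_le_bound _
    (mul_nonneg (euclNorm_nonneg _) (euclNorm_nonneg _)) ?_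
  intro y
  have e : Matrix.toEuclideanCLM (n := Fin n) (𝕜 := ℝ) (Matrix.vecMulVec r x) y =
      (inner ℝ (WithLp.toLp 2 x) y) • WithLp.toLp 2 r := by
    ext i
    rw [Matrix.ofLp_toEuclideanCLM]
    simp only [Matrix.vecMulVec, Matrix.mulVec, dotProduct, Matrix.of_apply, PiLp.smul_apply,
      smul_eq_mul, PiLp.inner_apply, RCLike.inner_apply, conj_trivial, Finset.sum_mul]
    exact Finset.sum_congr rfl fun j _ => by ring
  rw [e, norm_smul, euclNorm_eq_norm, euclNorm_eq_norm]
  have := norm_inner_le_norm (𝕜 := ℝ) (WithLp.toLp 2 x) y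
  nlinarith [norm_nonneg (WithLp.toLp 2 r)]

theorem specNorm_pos {A : Matrix (Fin n) (Fin n) ℝ} (hA : A.PosDef) {b : Fin n → ℝ}
    (hb : b ≠ 0) : 0 < specNorm A := by
  refine lt_of_le_of_ne (norm_nonneg _) fun h => ?_
  have h0 : euclNorm (A.mulVec b) = 0 :=
    le_antisymm (by simpa [← h] using euclNorm_mulVec_le A b) (euclNorm_nonneg _)
  have h1 : A.mulVec b = 0 := by
    by_contra hne
    exact (euclNorm_pos hne).ne' h0
  have := hA.dotProduct_mulVec_pos hb
  simp [h1] at this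

/-- The rank one perturbation `r xᵀ / ‖x‖²`, with `r` the residual, attains the infimum. -/
theorem berr_eq {A : Matrix (Fin n) (Fin n) ℝ} (hA : 0 < specNorm A) (b : Fin n → ℝ)
    {x : Fin n → ℝ} (hx : x ≠ 0) :
    berr A b x = ENNReal.ofReal (euclNorm (b - A.mulVec x) / euclNorm x / specNorm A) := by
  have hxp := euclNorm_pos hx
  apply le_antisymm
  · have hD : (A + Matrix.vecMulVec ((1 / (x ⬝ᵥ x)) • (b - A.mulVec x)) x).mulVec x = b := by
      have h0 : x ⬝ᵥ x ≠ 0 := by rw [← euclNorm_sq]; positivity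
      ext i
      simp only [Matrix.add_mulVec, Matrix.vecMulVec_mulVec, Pi.add_apply, Pi.smul_apply,
        Pi.sub_apply, smul_eq_mul, MulOpposite.smul_eq_mul_unop, MulOpposite.unop_op]
      field_simp
      ring
    refine iInf₂_le_of_le _ hD (ENNReal.ofReal_le_ofReal ?_)
    gcongr
    refine (specNorm_vecMulVec_le _ _).trans (le_of_eq ?_)
    have e : euclNorm ((1 / (x ⬝ᵥ x)) • (b - A.mulVec x)) =
        1 / (x ⬝ᵥ x) * euclNorm (b - A.mulVec x) := by
      rw [euclNorm_eq_norm, WithLp.toLp_smul, norm_smul, ← euclNorm_eq_norm, Real.norm_of_nonneg]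
      exact one_div_nonneg.2 (dotProduct_self_nonneg_real x)
    rw [e, ← euclNorm_sq]
    field_simp
  · refine le_iInf₂ fun D hD => ENNReal.ofReal_le_ofReal ?_
    gcongr
    rw [div_le_iff₀ hxp]
    have : b - A.mulVec x = D.mulVec x := by rw [← hD, Matrix.add_mulVec]; abel
    rw [this]
    exact euclNorm_mulVec_le D x

theorem berr_zero (A : Matrix (Fin n) (Fin n) ℝ) {b : Fin n → ℝ} (hb : b ≠ 0) :
    berr A b 0 = ⊤ := by
  refine iInf₂_eq_top.2 fun D hD => absurd ?_ hb
  rw [← hD, Matrix.mulVec_zero]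

end

/-! ### The Lanczos process -/

section

variable {n : ℕ}

/-- What the memory `s` satisfies after `k` Lanczos steps: the three-term recurrence, and
orthonormality of `q 1, …, q (k + 1)`, except that `q (k + 1)` has norm `1` only if
`β (k + 1) ≠ 0`. -/
structure IsLanczos (A : Matrix (Fin n) (Fin n) ℝ) (b : Fin n → ℝ) (k : ℕ) (s : State n) :
    Prop where
  q_zero : s.q 0 = 0
  q_one : b = euclNorm b • s.q 1
  recur : ∀ j, 1 ≤ j → j ≤ k →
    A.mulVec (s.q j) = s.β j • s.q (j - 1) + s.α j • s.q j + s.β (j + 1) • s.q (j + 1)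
  pos : ∀ j, 1 ≤ j → j ≤ k → 0 < s.β j
  nonneg : 0 ≤ s.β (k + 1)
  orth : ∀ i j, i ≤ k + 1 → j ≤ k + 1 → i ≠ j → s.q i ⬝ᵥ s.q j = 0
  norm : ∀ j, 1 ≤ j → j ≤ k → s.q j ⬝ᵥ s.q j = 1
  norm_last : s.β (k + 1) ≠ 0 → s.q (k + 1) ⬝ᵥ s.q (k + 1) = 1

/-- The memory after the `k`-th Lanczos step. -/
def lanczosNext (A : Matrix (Fin n) (Fin n) ℝ) (k : ℕ) (s : State n) : State n :=
  let wh : Fin n → ℝ := fun i => A.mulVec (s.q k) i - s.β k * s.q (k - 1) i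
  let a := wh ⬝ᵥ s.q k
  let w : Fin n → ℝ := fun i => wh i - a * s.q k i
  let c := euclNorm w
  { s with
    q := Function.update s.q (k + 1) fun i => w i / c
    α := Function.update s.α k a
    β := Function.update s.β (k + 1) c
    d := Function.update s.d k c
    e := Function.update s.e k (if 2 ≤ k then a else 0)
    f := Function.update s.f k (if 3 ≤ k then s.β k else 0) }

theorem det_lanczosStep (A : Matrix (Fin n) (Fin n) ℝ) (TA k : ℕ) (s : State n) :
    Prog.Det A TA (lanczosStep k s) (lanczosNext A k s) (TA + 9 * n + 1) := by
  refine Prog.Det.mono ?_ (c := TA + (n * 2 + (2 * n + (n * 2 + (2 * n + 1 + (n * 1 + 0))))))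
    (by omega)
  refine (Prog.det_matvecP _).bind ?_
  refine (Prog.det_vecP fun i => (Prog.det_mulP _ _).bind (Prog.det_subP _ _)).bind ?_
  refine (Prog.det_dotP _ _).bind ?_
  refine (Prog.det_vecP fun i => (Prog.det_mulP _ _).bind (Prog.det_subP _ _)).bind ?_
  refine (Prog.det_normP _).bind ?_
  refine (Prog.det_vecP fun i => Prog.det_divP _ _).bind ?_
  exact Prog.det_pure _

theorem isLanczos_init {A : Matrix (Fin n) (Fin n) ℝ} {b : Fin n → ℝ} (hb : b ≠ 0) :
    IsLanczos A b 0 (initState fun i => b i / euclNorm b) := by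
  have hp := euclNorm_pos hb
  have hn : (fun i => b i / euclNorm b) ⬝ᵥ (fun i => b i / euclNorm b) = 1 := by
    have h := euclNorm_sq b
    simp only [dotProduct, div_mul_div_comm, ← Finset.sum_div] at h ⊢
    rw [← h]
    field_simp
  refine ⟨by simp [initState]; rfl, ?_, fun j h1 h2 => by omega, fun j h1 h2 => by omega,
    by simp [initState], ?_, fun j h1 h2 => by omega, fun _ => by simpa [initState] using hn⟩
  · ext i
    simp only [initState, Function.update_self, Pi.smul_apply, smul_eq_mul]
    field_simp
  · intro i j hi hj hij
    have : i = 0 ∨ j = 0 := by omega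
    rcases this with rfl | rfl <;> simp [initState]

theorem IsLanczos.step {A : Matrix (Fin n) (Fin n) ℝ} (hA : A.IsSymm) {b : Fin n → ℝ} {k : ℕ}
    {s : State n} (h : IsLanczos A b k s) (hpos : 0 < s.β (k + 1)) :
    IsLanczos A b (k + 1) (lanczosNext A (k + 1) s) := by
  have hsym : ∀ x y : Fin n → ℝ, A.mulVec x ⬝ᵥ y = x ⬝ᵥ A.mulVec y := fun x y => by
    rw [Matrix.dotProduct_mulVec, ← Matrix.mulVec_transpose, hA.eq]
  set wh : Fin n → ℝ := A.mulVec (s.q (k + 1)) - s.β (k + 1) • s.q k with hwh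
  set a := wh ⬝ᵥ s.q (k + 1) with ha
  set w : Fin n → ℝ := wh - a • s.q (k + 1) with hw
  set c := euclNorm w with hc
  have hq : (lanczosNext A (k + 1) s).q = Function.update s.q (k + 2) (c⁻¹ • w) := by
    have : c⁻¹ • w = fun i => w i / c := by
      funext i; simp [div_eq_inv_mul]
    rw [this]; rfl
  have hα : (lanczosNext A (k + 1) s).α = Function.update s.α (k + 1) a := rfl
  have hβ : (lanczosNext A (k + 1) s).β = Function.update s.β (k + 2) c := rfl
  -- for `w = 0` the new vector is `w / 0 = 0`, which keeps the recurrence valid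
  have hcw : c • (c⁻¹ • w) = w := by
    by_cases h0 : w = 0
    · simp [h0]
    · rw [smul_smul, mul_inv_cancel₀ (euclNorm_pos h0).ne', one_smul]
  have hnorm : ∀ j, 1 ≤ j → j ≤ k + 1 → s.q j ⬝ᵥ s.q j = 1 := fun j h1 h2 => by
    rcases Nat.lt_or_ge j (k + 1) with h3 | h3
    · exact h.norm j h1 (by omega)
    · obtain rfl : j = k + 1 := by omega
      exact h.norm_last hpos.ne'
  have hww : ∀ j, j ≤ k + 1 → w ⬝ᵥ s.q j = 0 := by
    intro j hj
    rcases Nat.eq_zero_or_pos j with rfl | h1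
    · simp [h.q_zero]
    rcases Nat.lt_or_ge j (k + 1) with h3 | h3
    · rw [hw, hwh, sub_dotProduct, sub_dotProduct, hsym, smul_dotProduct, smul_dotProduct,
        h.orth (k + 1) j le_rfl hj (by omega), h.recur j h1 (by omega)]
      simp only [dotProduct_add, dotProduct_smul, smul_eq_mul]
      rw [h.orth (k + 1) (j - 1) le_rfl (by omega) (by omega),
        h.orth (k + 1) j le_rfl hj (by omega)]
      by_cases hjk : j = k
      · subst hjk
        rw [hnorm (j + 1) (by omega) le_rfl, hnorm j h1 (by omega)]
        ring
      · rw [h.orth (k + 1) (j + 1) le_rfl (by omega) (by omega),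
          h.orth k j (by omega) hj (by omega)]
        ring
    · obtain rfl : j = k + 1 := by omega
      rw [hw, sub_dotProduct, smul_dotProduct, hnorm (k + 1) h1 le_rfl, ← ha]
      simp
  have hqold : ∀ j, j ≤ k + 1 → (lanczosNext A (k + 1) s).q j = s.q j := fun j hj => by
    rw [hq, Function.update_of_ne (by omega)]
  have hqnew : (lanczosNext A (k + 1) s).q (k + 2) = c⁻¹ • w := by
    rw [hq, Function.update_self]
  have hβold : ∀ j, j ≤ k + 1 → (lanczosNext A (k + 1) s).β j = s.β j := fun j hj => by
    rw [hβ, Function.update_of_ne (by omega)]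
  have hβnew : (lanczosNext A (k + 1) s).β (k + 2) = c := by
    rw [hβ, Function.update_self]
  refine ⟨?_, ?_, ?_, ?_, ?_, ?_, ?_, ?_⟩
  · rw [hqold 0 (by omega), h.q_zero]
  · rw [hqold 1 (by omega)]; exact h.q_one
  · intro j h1 h2
    rcases Nat.lt_or_ge j (k + 1) with h3 | h3
    · rw [hqold j h2, hqold (j - 1) (by omega), hqold (j + 1) (by omega), hβold j h2,
        hβold (j + 1) (by omega), hα, Function.update_of_ne (by omega), h.recur j h1 (by omega)]
    · obtain rfl : j = k + 1 := by omega
      rw [hqold _ le_rfl, hqold _ (by omega), hqnew, hβold _ le_rfl, hβnew, hα,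
        Function.update_self, hcw, hw, hwh, Nat.add_sub_cancel]
      abel
  · intro j h1 h2
    rw [hβold j h2]
    rcases Nat.lt_or_ge j (k + 1) with h3 | h3
    · exact h.pos j h1 (by omega)
    · obtain rfl : j = k + 1 := by omega
      exact hpos
  · rw [hβnew]; exact euclNorm_nonneg _
  · intro i j hi hj hij
    rcases Nat.lt_or_ge i (k + 2) with hi' | hi'
    · rcases Nat.lt_or_ge j (k + 2) with hj' | hj'
      · rw [hqold i (by omega), hqold j (by omega)]
        exact h.orth i j (by omega) (by omega) hij
      · obtain rfl : j = k + 2 := by omega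
        rw [hqold i (by omega), hqnew, dotProduct_comm, smul_dotProduct, hww i (by omega),
          smul_zero]
    · obtain rfl : i = k + 2 := by omega
      rw [hqold j (by omega), hqnew, smul_dotProduct, hww j (by omega), smul_zero]
  · intro j h1 h2
    rw [hqold j h2]
    exact hnorm j h1 h2
  · intro hne
    rw [hβnew] at hne
    rw [hqnew, smul_dotProduct, dotProduct_smul, ← euclNorm_sq, ← hc]
    simp only [smul_eq_mul]
    field_simp

/-- The linear combination `∑ j, z j • q j` of the first `k` Lanczos vectors. -/
def comb (k : ℕ) (s : State n) (z : ℕ → ℝ) : Fin n → ℝ :=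
  ∑ j ∈ Finset.range k, z (j + 1) • s.q (j + 1)

/-- The squared Euclidean norm of the entries `z 1, …, z k`. -/
def sqSum (k : ℕ) (z : ℕ → ℝ) : ℝ := ∑ j ∈ Finset.range k, z (j + 1) ^ 2

theorem sqSum_nonneg (k : ℕ) (z : ℕ → ℝ) : 0 ≤ sqSum k z :=
  Finset.sum_nonneg fun _ _ => sq_nonneg _

theorem sqSum_pos {k : ℕ} {z : ℕ → ℝ} {j : ℕ} (h1 : 1 ≤ j) (h2 : j ≤ k) (hz : z j ≠ 0) :
    0 < sqSum k z := by
  refine Finset.sum_pos' (fun _ _ => sq_nonneg _) ⟨j - 1, Finset.mem_range.2 (by omega), ?_⟩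
  rw [Nat.sub_add_cancel h1]
  positivity

section

variable {A : Matrix (Fin n) (Fin n) ℝ} {b : Fin n → ℝ} {k : ℕ} {s : State n}

theorem IsLanczos.comb_dotProduct (h : IsLanczos A b k s) (z y : ℕ → ℝ) :
    comb k s z ⬝ᵥ comb k s y = ∑ j ∈ Finset.range k, z (j + 1) * y (j + 1) := by
  simp only [comb, sum_dotProduct, dotProduct_sum, smul_dotProduct, dotProduct_smul, smul_eq_mul]
  refine Finset.sum_congr rfl fun i hi => ?_
  rw [Finset.mem_range] at hi
  rw [Finset.sum_eq_single i]
  · rw [h.norm (i + 1) (by omega) (by omega), mul_one, mul_comm]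
  · intro j hj hji
    rw [Finset.mem_range] at hj
    rw [h.orth (j + 1) (i + 1) (by omega) (by omega) (by omega)]
    ring
  · intro h'; exact absurd (Finset.mem_range.2 hi) h'

theorem IsLanczos.comb_dotProduct_self (h : IsLanczos A b k s) (z : ℕ → ℝ) :
    comb k s z ⬝ᵥ comb k s z = sqSum k z := by
  rw [h.comb_dotProduct]
  exact Finset.sum_congr rfl fun j _ => (pow_two _).symm

/-- Orthonormal vectors in dimension `n` number at most `n`. -/
theorem IsLanczos.le_dim (h : IsLanczos A b k s) : k ≤ n := by
  have ho : Orthonormal ℝ fun i : Fin k =>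
      (WithLp.toLp 2 (s.q (i + 1)) : EuclideanSpace ℝ (Fin n)) := by
    have e : ∀ x y : Fin n → ℝ, inner ℝ (WithLp.toLp 2 x : EuclideanSpace ℝ (Fin n))
        (WithLp.toLp 2 y) = y ⬝ᵥ x := fun x y => by
      simp [PiLp.inner_apply, dotProduct]
    refine ⟨fun i => ?_, fun i j hij => ?_⟩
    · rw [← euclNorm_eq_norm, euclNorm, h.norm _ (by omega) (by omega), Real.sqrt_one]
    · refine (e _ _).trans ?_
      exact h.orth _ _ (by omega) (by omega) fun h' => hij (Fin.ext (by omega))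
  simpa using ho.linearIndependent.fintype_card_le_finrank

/-- The Lanczos vectors span the Krylov subspace. -/
theorem IsLanczos.mem_krylov_iff (h : IsLanczos A b k s) (hb : b ≠ 0) (x : Fin n → ℝ) :
    x ∈ krylov A b k ↔ ∃ z : ℕ → ℝ, x = comb k s z := by
  have mono : ∀ {i j}, i ≤ j → krylov A b i ≤ krylov A b j := by
    intro i j hij
    refine Submodule.span_mono ?_
    rintro _ ⟨l, rfl⟩
    exact ⟨⟨l, by omega⟩, rfl⟩
  have mapA : ∀ j, ∀ y ∈ krylov A b j, A.mulVec y ∈ krylov A b (j + 1) := by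
    intro j y hy
    have : krylov A b j ≤ (krylov A b (j + 1)).comap A.mulVecLin := by
      refine Submodule.span_le.2 ?_
      rintro _ ⟨l, rfl⟩
      refine Submodule.subset_span ⟨⟨l + 1, by omega⟩, ?_⟩
      simp only [Matrix.mulVecLin_apply, Matrix.mulVec_mulVec, pow_succ']
    exact this hy
  have hq : ∀ j, j ≤ k → s.q j ∈ krylov A b j := by
    intro j
    induction j using Nat.strong_induction_on with
    | _ j ih =>
      intro hj
      rcases Nat.lt_or_ge j 2 with h2 | h2
      · interval_cases j
        · rw [h.q_zero]; exact zero_mem _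
        · have hbm : b ∈ krylov A b 1 := Submodule.subset_span ⟨0, by simp⟩
          have e : s.q 1 = (euclNorm b)⁻¹ • b := by
            conv_rhs => rw [h.q_one]
            rw [smul_smul, ← h.q_one, inv_mul_cancel₀ (euclNorm_pos hb).ne', one_smul]
          rw [e]
          exact Submodule.smul_mem _ _ hbm
      · obtain ⟨i, rfl⟩ : ∃ i, j = i + 1 := ⟨j - 1, by omega⟩
        have hr := h.recur i (by omega) (by omega)
        have hβ := h.pos (i + 1) (by omega) hj
        have e : s.q (i + 1) = (s.β (i + 1))⁻¹ •
            (A.mulVec (s.q i) - s.β i • s.q (i - 1) - s.α i • s.q i) := by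
          rw [hr, add_sub_assoc, add_sub_assoc, eq_inv_smul_iff₀ hβ.ne']
          abel
        rw [e]
        refine Submodule.smul_mem _ _ (Submodule.sub_mem _ (Submodule.sub_mem _ ?_ ?_) ?_)
        · exact mapA i _ (ih i (by omega) (by omega))
        · exact Submodule.smul_mem _ _ (mono (by omega) (ih (i - 1) (by omega) (by omega)))
        · exact Submodule.smul_mem _ _ (mono (by omega) (ih i (by omega) (by omega)))
  constructor
  · -- the spans of the first `j` Lanczos vectors, as `j` grows, absorb the powers of `A`
    have hpow : ∀ i, i < k → (A ^ i).mulVec b ∈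
        Submodule.span ℝ (s.q '' {j | 1 ≤ j ∧ j ≤ i + 1}) := by
      intro i
      induction i with
      | zero =>
        intro _
        rw [pow_zero, Matrix.one_mulVec]
        rw [h.q_one]
        exact Submodule.smul_mem _ _ (Submodule.subset_span ⟨1, ⟨le_rfl, by omega⟩, rfl⟩)
      | succ i ih =>
        intro hi
        have hm : Submodule.span ℝ (s.q '' {j | 1 ≤ j ∧ j ≤ i + 1}) ≤
            (Submodule.span ℝ (s.q '' {j | 1 ≤ j ∧ j ≤ i + 1 + 1})).comap A.mulVecLin := by
          refine Submodule.span_le.2 ?_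
          rintro _ ⟨j, ⟨h1, h2⟩, rfl⟩
          have hmem : ∀ l, l ≤ i + 1 + 1 →
              s.q l ∈ Submodule.span ℝ (s.q '' {j | 1 ≤ j ∧ j ≤ i + 1 + 1}) := fun l hl => by
            rcases Nat.eq_zero_or_pos l with rfl | hl0
            · rw [h.q_zero]; exact zero_mem _
            · exact Submodule.subset_span ⟨l, ⟨hl0, hl⟩, rfl⟩
          simp only [Submodule.comap_coe, Set.mem_preimage, Matrix.mulVecLin_apply, SetLike.mem_coe]
          rw [h.recur j h1 (by omega)]
          exact Submodule.add_mem _ (Submodule.add_mem _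
            (Submodule.smul_mem _ _ (hmem _ (by omega)))
            (Submodule.smul_mem _ _ (hmem _ (by omega))))
            (Submodule.smul_mem _ _ (hmem _ (by omega)))
        rw [pow_succ', ← Matrix.mulVec_mulVec]
        exact hm (ih (by omega))
    intro hx
    have hsub : krylov A b k ≤ Submodule.span ℝ (Set.range fun i : Fin k => s.q (i + 1)) := by
      refine Submodule.span_le.2 ?_
      rintro _ ⟨i, rfl⟩
      refine Submodule.span_mono ?_ (hpow i i.2)
      rintro _ ⟨j, ⟨h1, h2⟩, rfl⟩
      exact ⟨⟨j - 1, by omega⟩, by simp only; rw [Nat.sub_add_cancel h1]⟩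
    obtain ⟨c, rfl⟩ := (Submodule.mem_span_range_iff_exists_fun ℝ).1 (hsub hx)
    refine ⟨fun j => if hj : j - 1 < k then c ⟨j - 1, hj⟩ else 0, ?_⟩
    rw [comb, Finset.sum_range]
    exact Finset.sum_congr rfl fun i _ => by simp
  · rintro ⟨z, rfl⟩
    refine Submodule.sum_mem _ fun j hj => Submodule.smul_mem _ _ ?_
    rw [Finset.mem_range] at hj
    exact mono (by omega) (hq (j + 1) (by omega))

end

end

/-! ### Upper triangular matrices with three diagonals -/

section

/-- Entry `i` of `U z` for the upper triangular matrix `U` with diagonal `d j = U j j` and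
superdiagonals `e j = U (j - 1) j`, `f j = U (j - 2) j`. -/
def upperMul (d e f z : ℕ → ℝ) (i : ℕ) : ℝ :=
  d i * z i + e (i + 1) * z (i + 1) + f (i + 2) * z (i + 2)

/-- The vector `z` has its nonzero entries at the indices `1, …, k`. -/
def SuppOn (k : ℕ) (z : ℕ → ℝ) : Prop := ∀ j, j = 0 ∨ k < j → z j = 0

/-- `‖U z‖²` summed up column by column, that is, through the entries of `Uᵀ U`. The terms after
the first sum are the products that involve the columns `k + 1` and `k + 2`. -/
theorem sum_upperMul_sq (d e f z : ℕ → ℝ) (h1 : e 1 = 0) (h2 : f 2 = 0) (h0 : e 0 = 0)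
    (hf : f 1 = 0) (k : ℕ) :
    ∑ j ∈ Finset.range k, upperMul d e f z (j + 1) ^ 2 =
      ∑ j ∈ Finset.range k, (z (j + 1) ^ 2 * (d (j + 1) ^ 2 + e (j + 1) ^ 2 + f (j + 1) ^ 2) +
        2 * z j * z (j + 1) * (d j * e (j + 1) + e j * f (j + 1)) +
        2 * z (j - 1) * z (j + 1) * (d (j - 1) * f (j + 1))) +
      (upperMul d e f z k ^ 2 - (d k * z k) ^ 2 +
        (d (k - 1) * z (k - 1) + e k * z k + f (k + 1) * z (k + 1)) ^ 2 -
        (d (k - 1) * z (k - 1) + e k * z k) ^ 2) := by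
  induction k with
  | zero => simp [upperMul, h1, h2, h0, hf]
  | succ k ih =>
    rw [Finset.sum_range_succ, Finset.sum_range_succ, ih]
    simp only [upperMul, Nat.add_sub_cancel]
    ring

/-- If the columns of `Uᵀ U - ε² I` agree with those of `Rᵀ R`, except that the last diagonal
entry of the former exceeds that of the latter by `p`, then the quadratic forms agree up to the
square `p * z k ^ 2`. -/
theorem sum_upperMul_sq_sub {d e f r0 r1 r2 : ℕ → ℝ} {ε p : ℝ} {k : ℕ} {z : ℕ → ℝ}
    (he : e 0 = 0 ∧ e 1 = 0) (hf : f 1 = 0 ∧ f 2 = 0) (hr1 : r1 0 = 0 ∧ r1 1 = 0)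
    (hr2 : r2 1 = 0 ∧ r2 2 = 0) (hz : SuppOn k z)
    (hdiag : ∀ j, 1 ≤ j → j ≤ k → d j ^ 2 + e j ^ 2 + f j ^ 2 - ε ^ 2 =
      r0 j ^ 2 + r1 j ^ 2 + r2 j ^ 2 + if j = k then p else 0)
    (hsup1 : ∀ j, 1 ≤ j → j ≤ k →
      d (j - 1) * e j + e (j - 1) * f j = r0 (j - 1) * r1 j + r1 (j - 1) * r2 j)
    (hsup2 : ∀ j, 1 ≤ j → j ≤ k → d (j - 2) * f j = r0 (j - 2) * r2 j) :
    ∑ j ∈ Finset.range k, upperMul d e f z (j + 1) ^ 2 - ε ^ 2 * sqSum k z =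
      ∑ j ∈ Finset.range k, upperMul r0 r1 r2 z (j + 1) ^ 2 + p * z k ^ 2 := by
  have hp : p * z k ^ 2 = ∑ j ∈ Finset.range k, z (j + 1) ^ 2 * if j + 1 = k then p else 0 := by
    rcases Nat.eq_zero_or_pos k with rfl | hk
    · simp [hz 0 (Or.inl rfl)]
    · rw [Finset.sum_eq_single (k - 1)]
      · rw [Nat.sub_add_cancel hk, if_pos rfl, mul_comm]
      · intro j _ hj
        rw [if_neg (by omega), mul_zero]
      · intro h; exact absurd (Finset.mem_range.2 (by omega)) h
  rw [sum_upperMul_sq d e f z he.2 hf.2 he.1 hf.1, sum_upperMul_sq r0 r1 r2 z hr1.2 hr2.2 hr1.1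
    hr2.1, hp]
  simp only [upperMul, hz (k + 1) (Or.inr (by omega)), hz (k + 2) (Or.inr (by omega)), mul_zero,
    add_zero, zero_add, sub_self, sqSum, Finset.mul_sum]
  rw [← Finset.sum_sub_distrib, ← Finset.sum_add_distrib]
  refine Finset.sum_congr rfl fun j hj => ?_
  rw [Finset.mem_range] at hj
  have a0 := hdiag (j + 1) (by omega) (by omega)
  have a1 := hsup1 (j + 1) (by omega) (by omega)
  have a2 := hsup2 (j + 1) (by omega) (by omega)
  simp only [Nat.add_sub_cancel, Nat.reduceSubDiff] at a1 a2
  rw [a1, a2]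
  linear_combination z (j + 1) ^ 2 * a0

/-- The result of `solveUpper`: back substitution for the equations `i, …, 1` of `U v = z`. -/
def backSub (d e f z : ℕ → ℝ) : ℕ → (ℕ → ℝ) → ℕ → ℝ
  | 0, v => v
  | i + 1, v => backSub d e f z i (Function.update v (i + 1)
      ((z (i + 1) - e (i + 2) * v (i + 2) - f (i + 3) * v (i + 3)) / d (i + 1)))

theorem backSub_apply (d e f z : ℕ → ℝ) (i : ℕ) (v : ℕ → ℝ) {j : ℕ} (hj : j = 0 ∨ i < j) :
    backSub d e f z i v j = v j := by
  induction i generalizing v with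
  | zero => rfl
  | succ i ih =>
    rw [backSub, ih _ (by omega), Function.update_of_ne (by omega)]

theorem upperMul_backSub {d e f : ℕ → ℝ} (z : ℕ → ℝ) {i : ℕ} (v : ℕ → ℝ)
    (hd : ∀ j, 1 ≤ j → j ≤ i → d j ≠ 0) {j : ℕ} (h1 : 1 ≤ j) (hj : j ≤ i) :
    upperMul d e f (backSub d e f z i v) j = z j := by
  induction i generalizing v with
  | zero => omega
  | succ i ih =>
    rcases Nat.lt_or_ge j (i + 1) with h | h
    · rw [backSub]
      exact ih _ (fun l h1 h2 => hd l h1 (by omega)) (by omega)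
    · obtain rfl : j = i + 1 := by omega
      rw [backSub, upperMul, backSub_apply _ _ _ _ _ _ (Or.inr (by omega)),
        backSub_apply _ _ _ _ _ _ (Or.inr (by omega)),
        backSub_apply _ _ _ _ _ _ (Or.inr (by omega)), Function.update_self,
        Function.update_of_ne (by omega), Function.update_of_ne (by omega)]
      have := hd (i + 1) (by omega) le_rfl
      field_simp
      ring

/-- The solution of the first `k - 1` equations of `U v = 0` with last entry `1`. -/
def nullVec (d e f : ℕ → ℝ) (k : ℕ) : ℕ → ℝ :=
  backSub d e f (fun _ => 0) (k - 1) (Function.update (fun _ => 0) k 1)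

theorem nullVec_last (d e f : ℕ → ℝ) {k : ℕ} (hk : 1 ≤ k) : nullVec d e f k k = 1 := by
  rw [nullVec, backSub_apply _ _ _ _ _ _ (Or.inr (by omega)), Function.update_self]

theorem nullVec_suppOn (d e f : ℕ → ℝ) {k : ℕ} (hk : 1 ≤ k) : SuppOn k (nullVec d e f k) := by
  intro j hj
  rw [nullVec, backSub_apply _ _ _ _ _ _ (by omega), Function.update_of_ne (by omega)]

theorem upperMul_nullVec {d e f : ℕ → ℝ} {k : ℕ} (hd : ∀ j, 1 ≤ j → j < k → d j ≠ 0) {j : ℕ}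
    (h1 : 1 ≤ j) (hj : j < k) : upperMul d e f (nullVec d e f k) j = 0 :=
  upperMul_backSub _ _ (fun l h1 h2 => hd l h1 (by omega)) h1 (by omega)

theorem upperMul_add (d e f z y : ℕ → ℝ) (i : ℕ) :
    upperMul d e f (fun j => z j + y j) i = upperMul d e f z i + upperMul d e f y i := by
  simp only [upperMul]; ring

theorem upperMul_smul (d e f z : ℕ → ℝ) (c : ℝ) (i : ℕ) :
    upperMul d e f (fun j => c * z j) i = c * upperMul d e f z i := by
  simp only [upperMul]; ring

/-! ### The Krylov residual in Lanczos coordinates -/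

variable {n : ℕ}

/-- The product `T' z`, where `T'` is the Lanczos matrix without its first row. -/
def State.mul (s : State n) (z : ℕ → ℝ) (i : ℕ) : ℝ := upperMul s.d s.e s.f z i

/-- The memory holds the diagonals of `T'`. -/
structure IsBand (k : ℕ) (s : State n) : Prop where
  d_zero : s.d 0 = 0
  e_zero : s.e 0 = 0
  f_two : s.f 2 = 0
  d_eq : ∀ j, 1 ≤ j → j ≤ k → s.d j = s.β (j + 1)
  e_eq : ∀ j, 1 ≤ j → j ≤ k → s.e j = if 2 ≤ j then s.α j else 0
  f_eq : ∀ j, 1 ≤ j → j ≤ k → s.f j = if 3 ≤ j then s.β j else 0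

/-- The entry `T 1 1 * z 1 + T 1 2 * z 2` of `T z` that belongs to the removed row. -/
def State.firstRow (s : State n) (z : ℕ → ℝ) : ℝ := s.α 1 * z 1 + s.β 2 * z 2

section

variable {A : Matrix (Fin n) (Fin n) ℝ} {b : Fin n → ℝ} {k : ℕ} {s : State n}

/-- `A Q z` for the first `i` Lanczos vectors, with the tridiagonal matrix applied to all of `z`; the
subtracted terms are those that involve entries of `z` beyond `i`. -/
theorem IsLanczos.mulVec_comb_aux (h : IsLanczos A b k s) {z : ℕ → ℝ} (hz : z 0 = 0) {i : ℕ}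
    (hi : i ≤ k) :
    A.mulVec (comb i s z) = ∑ j ∈ Finset.range (i + 1),
        (s.β (j + 1) * z j + s.α (j + 1) * z (j + 1) + s.β (j + 2) * z (j + 2)) • s.q (j + 1) -
      (s.α (i + 1) * z (i + 1) + s.β (i + 2) * z (i + 2)) • s.q (i + 1) -
      (s.β (i + 1) * z (i + 1)) • s.q i := by
  induction i with
  | zero => simp [comb, hz, h.q_zero]
  | succ i ih =>
    have e : comb (i + 1) s z = comb i s z + z (i + 1) • s.q (i + 1) := Finset.sum_range_succ _ _
    rw [e, Matrix.mulVec_add, ih (by omega), Matrix.mulVec_smul, h.recur (i + 1) (by omega) hi,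
      Finset.sum_range_succ _ (i + 1), Nat.add_sub_cancel]
    module

theorem IsBand.mul_eq (hB : IsBand k s) {z : ℕ → ℝ} (hz : SuppOn k z) {j : ℕ} (h1 : 1 ≤ j)
    (hj : j ≤ k) :
    s.mul z j = s.β (j + 1) * z j + s.α (j + 1) * z (j + 1) + s.β (j + 2) * z (j + 2) := by
  have h2 : s.e (j + 1) * z (j + 1) = s.α (j + 1) * z (j + 1) := by
    by_cases h : j + 1 ≤ k
    · rw [hB.e_eq _ (by omega) h, if_pos (by omega)]
    · rw [hz _ (Or.inr (by omega)), mul_zero, mul_zero]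
  have h3 : s.f (j + 2) * z (j + 2) = s.β (j + 2) * z (j + 2) := by
    by_cases h : j + 2 ≤ k
    · rw [hB.f_eq _ (by omega) h, if_pos (by omega)]
    · rw [hz _ (Or.inr (by omega)), mul_zero, mul_zero]
  rw [State.mul, upperMul, h2, h3, hB.d_eq j h1 hj]

/-- The Lanczos relation `A Q z = Q⁺ T z`. -/
theorem IsLanczos.mulVec_comb (h : IsLanczos A b k s) (hB : IsBand k s) {z : ℕ → ℝ}
    (hz : SuppOn k z) :
    A.mulVec (comb k s z) =
      s.firstRow z • s.q 1 + ∑ j ∈ Finset.range k, s.mul z (j + 1) • s.q (j + 2) := by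
  rw [h.mulVec_comb_aux (hz 0 (Or.inl rfl)) le_rfl, hz (k + 1) (Or.inr (by omega)),
    hz (k + 2) (Or.inr (by omega)), Finset.sum_range_succ', add_comm]
  simp only [mul_zero, add_zero, zero_smul, sub_zero, zero_add, hz 0 (Or.inl rfl)]
  congr 1
  refine Finset.sum_congr rfl fun j hj => ?_
  rw [Finset.mem_range] at hj
  rw [hB.mul_eq hz (by omega) (by omega)]

theorem IsLanczos.comb_succ_dotProduct_self (h : IsLanczos A b k s) (y : ℕ → ℝ)
    (hy : s.β (k + 1) = 0 → y (k + 1) = 0) :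
    comb (k + 1) s y ⬝ᵥ comb (k + 1) s y = sqSum (k + 1) y := by
  have e : comb (k + 1) s y = comb k s y + y (k + 1) • s.q (k + 1) := Finset.sum_range_succ _ _
  have h0 : comb k s y ⬝ᵥ s.q (k + 1) = 0 := by
    rw [comb, sum_dotProduct]
    refine Finset.sum_eq_zero fun j hj => ?_
    rw [Finset.mem_range] at hj
    rw [smul_dotProduct, h.orth _ _ (by omega) le_rfl (by omega), smul_zero]
  rw [e, add_dotProduct, dotProduct_add, dotProduct_add, h.comb_dotProduct_self, dotProduct_smul,
    smul_dotProduct, smul_dotProduct, dotProduct_smul, dotProduct_comm (s.q (k + 1)), h0, sqSum,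
    sqSum, Finset.sum_range_succ]
  by_cases hβ : s.β (k + 1) = 0
  · simp [hy hβ]
  · simp [h.norm_last hβ, pow_two]

/-- The residual splits into the part along `b` and the part `T' z`. -/
theorem IsLanczos.residual_sq (h : IsLanczos A b k s) (hB : IsBand k s) (hk : 1 ≤ k)
    {z : ℕ → ℝ} (hz : SuppOn k z) :
    euclNorm (b - A.mulVec (comb k s z)) ^ 2 =
      (euclNorm b - s.firstRow z) ^ 2 + sqSum k (s.mul z) := by
  obtain ⟨c, hc⟩ : ∃ c, c = euclNorm b := ⟨_, rfl⟩
  have hb : b = c • s.q 1 := hc ▸ h.q_one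
  rw [← hc]
  let y : ℕ → ℝ := fun j => if j = 1 then c - s.firstRow z else -s.mul z (j - 1)
  have e : b - A.mulVec (comb k s z) = comb (k + 1) s y := by
    rw [h.mulVec_comb hB hz, comb, Finset.sum_range_succ']
    conv_lhs => rw [hb]
    have : ∀ j, y (j + 1 + 1) = -s.mul z (j + 1) := fun j => if_neg (by omega)
    simp only [this, neg_smul, Finset.sum_neg_distrib]
    simp only [y, zero_add, if_true]
    module
  rw [euclNorm_sq, e, h.comb_succ_dotProduct_self y, sqSum, Finset.sum_range_succ', add_comm]
  · congr 1
    refine Finset.sum_congr rfl fun j _ => ?_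
    have : y (j + 1 + 1) = -s.mul z (j + 1) := if_neg (by omega)
    rw [this, neg_sq]
  · intro hβ
    have : y (k + 1) = -s.mul z k := if_neg (by omega)
    rw [this, hB.mul_eq hz hk le_rfl, hβ, hz (k + 1) (Or.inr (by omega)),
      hz (k + 2) (Or.inr (by omega))]
    ring

/-- The compression `Qᵀ A Q` of `A` to the Krylov subspace is positive definite. -/
theorem IsLanczos.compression_pos (hA : A.PosDef) (h : IsLanczos A b k s) {z : ℕ → ℝ}
    (hz : SuppOn k z) {l : ℕ} (h1 : 1 ≤ l) (hl : l ≤ k) (hne : z l ≠ 0) :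
    0 < ∑ j ∈ Finset.range k, z (j + 1) *
      (s.β (j + 1) * z j + s.α (j + 1) * z (j + 1) + s.β (j + 2) * z (j + 2)) := by
  have hx : comb k s z ≠ 0 := fun h0 => by
    have := h.comb_dotProduct_self z
    rw [h0, zero_dotProduct] at this
    exact (sqSum_pos h1 hl hne).ne this
  have hp := hA.dotProduct_mulVec_pos hx
  rw [h.mulVec_comb_aux (hz 0 (Or.inl rfl)) le_rfl, hz (k + 1) (Or.inr (by omega)),
    hz (k + 2) (Or.inr (by omega)), Finset.sum_range_succ] at hp
  have h0 : comb k s z ⬝ᵥ s.q (k + 1) = 0 := by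
    rw [comb, sum_dotProduct]
    refine Finset.sum_eq_zero fun j hj => ?_
    rw [Finset.mem_range] at hj
    rw [smul_dotProduct, h.orth _ _ (by omega) le_rfl (by omega), smul_zero]
  simp only [mul_zero, add_zero, zero_smul, sub_zero, star_trivial, dotProduct_add,
    dotProduct_smul, h0, smul_zero] at hp
  have hc := h.comb_dotProduct z fun j =>
    s.β j * z (j - 1) + s.α j * z j + s.β (j + 1) * z (j + 1)
  rw [comb, comb] at hc
  simp only [Nat.add_sub_cancel] at hc
  rw [comb, hc] at hp
  exact hp

/-- Suppose that `z` and `T' z` alternate in sign beyond the index `i`, and let `t` be the part of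
`z` beyond `i`. If `t ≠ 0` then entry `i + 1` of `Qᵀ A Q t` has the sign of `z (i + 1)`: the
quadratic form of `Qᵀ A Q` at `t` is positive, and its terms with larger indices are products
`z (j + 1) * (T' z) j ≤ 0`. -/
theorem IsLanczos.tail_pos (hA : A.PosDef) (h : IsLanczos A b k s) (hB : IsBand k s)
    {z : ℕ → ℝ} (hz : SuppOn k z) {i : ℕ} (hi : i < k)
    (hsign : ∀ j, i < j → j ≤ k → 0 ≤ (-1) ^ j * z j)
    (hmul : ∀ j, i < j → j < k → 0 ≤ (-1) ^ j * s.mul z j)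
    {l : ℕ} (h1 : i < l) (hl : l ≤ k) (hne : z l ≠ 0) :
    0 < z (i + 1) * (s.α (i + 1) * z (i + 1) + s.β (i + 2) * z (i + 2)) := by
  let t : ℕ → ℝ := fun j => if i < j then z j else 0
  have ht : SuppOn k t := by
    intro j hj
    by_cases hij : i < j
    · simp only [t, if_pos hij]; exact hz j hj
    · simp only [t, if_neg hij]
  have hgt : ∀ j, i < j → t j = z j := fun j hj => if_pos hj
  have hle : ∀ j, j ≤ i → t j = 0 := fun j hj => if_neg (by omega)
  refine (h.compression_pos hA ht (by omega) hl (by rwa [hgt l h1])).trans_le ?_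
  have e : z (i + 1) * (s.α (i + 1) * z (i + 1) + s.β (i + 2) * z (i + 2)) =
      ∑ j ∈ Finset.range k, if j = i then
        z (i + 1) * (s.α (i + 1) * z (i + 1) + s.β (i + 2) * z (i + 2)) else 0 := by
    rw [Finset.sum_ite_eq', if_pos (Finset.mem_range.2 hi)]
  rw [e]
  refine Finset.sum_le_sum fun j hj => ?_
  rw [Finset.mem_range] at hj
  rcases lt_trichotomy j i with hji | rfl | hji
  · rw [hle (j + 1) (by omega), zero_mul, if_neg hji.ne]
  · rw [if_pos rfl, hgt (j + 1) (by omega), hgt (j + 2) (by omega), hle j le_rfl, mul_zero, zero_add]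
  · rw [if_neg hji.ne', hgt (j + 1) (by omega), hgt (j + 2) (by omega), hgt j hji,
      ← hB.mul_eq hz (by omega) hj.le]
    have a1 := hsign (j + 1) (by omega) hj
    have a2 := hmul j hji hj
    rw [pow_succ] at a1
    have a3 := mul_nonneg a1 a2
    have a4 : ((-1 : ℝ) ^ j) * (-1) ^ j = 1 := by rw [← mul_pow]; norm_num
    have a5 : (-1 : ℝ) ^ j * -1 * z (j + 1) * ((-1) ^ j * s.mul z j) =
        -(((-1 : ℝ) ^ j) * (-1) ^ j) * (z (j + 1) * s.mul z j) := by ring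
    rw [a5, a4] at a3
    linarith

/-- The inverse of `T'` has the checkerboard sign pattern, because the compression `Qᵀ A Q` is
positive definite. The last entry gets its own hypothesis so that a zero last diagonal entry is
allowed. -/
theorem IsLanczos.alternating (hA : A.PosDef) (h : IsLanczos A b k s) (hB : IsBand k s)
    {z : ℕ → ℝ} (hz : SuppOn k z) (hlast : 0 ≤ (-1) ^ k * z k)
    (hmul : ∀ j, 1 ≤ j → j < k → 0 ≤ (-1) ^ j * s.mul z j) (j : ℕ) (h1 : 1 ≤ j) (hj : j ≤ k) :
    0 ≤ (-1) ^ j * z j := by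
  suffices H : ∀ m i, i + m = k → 1 ≤ i → ∀ j, i ≤ j → j ≤ k → 0 ≤ (-1) ^ j * z j from
    H (k - j) j (by omega) h1 j le_rfl hj
  intro m
  induction m with
  | zero =>
    intro i hi _ j h2 h3
    obtain rfl : j = k := by omega
    exact hlast
  | succ m ih =>
    intro i hi hi1 j h2 h3
    have hs := ih (i + 1) (by omega) (by omega)
    rcases Nat.lt_or_ge i j with hij | hij
    · exact hs j hij h3
    obtain rfl : j = i := by omega
    have hd : 0 < s.β (j + 1) := h.pos _ (by omega) (by omega)
    have hm := hmul j hi1 (by omega)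
    rw [hB.mul_eq hz hi1 h3] at hm
    have hX : 0 ≤ (-1) ^ (j + 1) * (s.α (j + 1) * z (j + 1) + s.β (j + 2) * z (j + 2)) := by
      by_cases hzero : ∃ l, j < l ∧ l ≤ k ∧ z l ≠ 0
      · obtain ⟨l, l1, l2, l3⟩ := hzero
        have hp := h.tail_pos hA hB hz (by omega) hs
          (fun l h1 h2 => hmul l (by omega) h2) l1 l2 l3
        have hs1 := hs (j + 1) le_rfl (by omega)
        have h4 : ((-1 : ℝ) ^ (j + 1)) * (-1) ^ (j + 1) = 1 := by rw [← mul_pow]; norm_num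
        set X := s.α (j + 1) * z (j + 1) + s.β (j + 2) * z (j + 2)
        by_contra hneg
        push Not at hneg
        have h5 := mul_nonpos_of_nonneg_of_nonpos hs1 hneg.le
        have h6 : (-1 : ℝ) ^ (j + 1) * z (j + 1) * ((-1) ^ (j + 1) * X) =
          (((-1 : ℝ) ^ (j + 1)) * (-1) ^ (j + 1)) * (z (j + 1) * X) := by ring
        rw [h6, h4] at h5
        linarith
      · push Not at hzero
        have hz1 : ∀ l, j < l → z l = 0 := fun l hl => by
          by_cases hlk : l ≤ k
          · exact hzero l hl hlk
          · exact hz l (Or.inr (by omega))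
        rw [hz1 (j + 1) (by omega), hz1 (j + 2) (by omega)]
        simp
    rw [pow_succ] at hX
    have : s.β (j + 1) * ((-1) ^ j * z j) = (-1) ^ j * (s.β (j + 1) * z j +
        s.α (j + 1) * z (j + 1) + s.β (j + 2) * z (j + 2)) +
        (-1) ^ j * -1 * (s.α (j + 1) * z (j + 1) + s.β (j + 2) * z (j + 2)) := by ring
    exact nonneg_of_mul_nonneg_right (by rw [this]; exact add_nonneg hm hX) hd

/-- The same sign argument at the removed first row of `T`. -/
theorem IsLanczos.firstRow_ne_zero (hA : A.PosDef) (h : IsLanczos A b k s) (hB : IsBand k s)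
    {z : ℕ → ℝ} (hz : SuppOn k z) (hlast : 0 ≤ (-1) ^ k * z k)
    (hmul : ∀ j, 1 ≤ j → j < k → 0 ≤ (-1) ^ j * s.mul z j) {l : ℕ} (h1 : 1 ≤ l) (hl : l ≤ k)
    (hne : z l ≠ 0) : s.firstRow z ≠ 0 := by
  have := h.tail_pos hA hB hz (i := 0) (by omega)
    (fun j h1 h2 => h.alternating hA hB hz hlast hmul j h1 h2)
    (fun j h1 h2 => hmul j h1 h2) h1 hl hne
  exact right_ne_zero_of_mul this.ne'

/-- For every `z` there is a `z'` with `‖T' z'‖ = ‖T' z‖`, `‖z'‖ ≥ ‖z‖` and nonzero first row: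
the entries of `T' z'` are those of `T' z` with their signs made alternating. -/
theorem IsLanczos.exists_firstRow_ne_zero (hA : A.PosDef) (h : IsLanczos A b k s)
    (hB : IsBand k s) (hd : s.β (k + 1) ≠ 0) {z : ℕ → ℝ} (hz : SuppOn k z)
    (hne : 0 < sqSum k z) :
    ∃ z', SuppOn k z' ∧ sqSum k (s.mul z') = sqSum k (s.mul z) ∧ sqSum k z ≤ sqSum k z' ∧
      s.firstRow z' ≠ 0 := by
  have hd' : ∀ j, 1 ≤ j → j ≤ k → 0 < s.d j := fun j h1 h2 => by
    rw [hB.d_eq j h1 h2]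
    rcases Nat.lt_or_ge j k with h3 | h3
    · exact h.pos _ (by omega) (by omega)
    · obtain rfl : j = k := by omega
      exact h.nonneg.lt_of_ne' hd
  set z' := backSub s.d s.e s.f (fun j => (-1) ^ j * |s.mul z j|) k (fun _ => 0) with hz'
  have hs' : SuppOn k z' := fun j hj => backSub_apply _ _ _ _ _ _ hj
  have hm' : ∀ j, 1 ≤ j → j ≤ k → s.mul z' j = (-1) ^ j * |s.mul z j| := fun j h1 h2 =>
    upperMul_backSub _ _ (fun l h1 h2 => (hd' l h1 h2).ne') h1 h2
  have hsq : ∀ j : ℕ, (-1 : ℝ) ^ j * (-1) ^ j = 1 := fun j => by rw [← mul_pow]; norm_num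
  have key : ∀ y : ℕ → ℝ, SuppOn k y → (∀ j, 1 ≤ j → j ≤ k → 0 ≤ (-1) ^ j * s.mul y j) →
      0 ≤ (-1) ^ k * y k := by
    intro y hy hm
    rcases Nat.eq_zero_or_pos k with rfl | hk
    · rw [hy 0 (Or.inl rfl), mul_zero]
    have := hm k hk le_rfl
    rw [State.mul, upperMul, hy (k + 1) (Or.inr (by omega)), hy (k + 2) (Or.inr (by omega)),
      mul_zero, mul_zero, add_zero, add_zero, mul_left_comm] at this
    exact nonneg_of_mul_nonneg_right this (hd' k hk le_rfl)
  have alt : ∀ y : ℕ → ℝ, SuppOn k y → (∀ j, 1 ≤ j → j ≤ k → 0 ≤ (-1) ^ j * s.mul y j) →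
      ∀ j, 1 ≤ j → j ≤ k → 0 ≤ (-1) ^ j * y j := fun y hy hm =>
    h.alternating hA hB hy (key y hy hm) fun j h1 h2 => hm j h1 h2.le
  have habs : ∀ c : ℝ, c = 1 ∨ c = -1 → ∀ j, 1 ≤ j → j ≤ k →
      0 ≤ (-1) ^ j * (z' j + c * z j) := by
    intro c hc
    refine alt (fun j => z' j + c * z j) (fun j hj => by simp [hs' j hj, hz j hj]) ?_
    intro j h1 h2
    rw [State.mul, upperMul_add, upperMul_smul]
    change 0 ≤ (-1) ^ j * (s.mul z' j + c * s.mul z j)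
    rw [hm' j h1 h2, mul_add, ← mul_assoc, hsq, one_mul]
    have h3 : |(-1) ^ j * (c * s.mul z j)| = |s.mul z j| := by
      rcases hc with rfl | rfl <;> simp [abs_mul]
    have := neg_abs_le ((-1) ^ j * (c * s.mul z j))
    linarith
  have hle : sqSum k z ≤ sqSum k z' := by
    refine Finset.sum_le_sum fun j hj => ?_
    rw [Finset.mem_range] at hj
    have p := habs 1 (Or.inl rfl) (j + 1) (by omega) (by omega)
    have m := habs (-1) (Or.inr rfl) (j + 1) (by omega) (by omega)
    have e := mul_nonneg p m
    have : (-1) ^ (j + 1) * (z' (j + 1) + 1 * z (j + 1)) *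
        ((-1) ^ (j + 1) * (z' (j + 1) + -1 * z (j + 1))) =
        ((-1) ^ (j + 1) * (-1) ^ (j + 1)) * (z' (j + 1) ^ 2 - z (j + 1) ^ 2) := by ring
    rw [this, hsq] at e
    linarith
  have hnn : ∀ j, 1 ≤ j → j ≤ k → 0 ≤ (-1) ^ j * s.mul z' j := fun j h1 h2 => by
    rw [hm' j h1 h2, ← mul_assoc, hsq, one_mul]; exact abs_nonneg _
  refine ⟨z', hs', ?_, hle, ?_⟩
  · refine Finset.sum_congr rfl fun j hj => ?_
    rw [Finset.mem_range] at hj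
    rw [hm' (j + 1) (by omega) (by omega), mul_pow, sq_abs, ← pow_mul, mul_comm (j + 1) 2,
      pow_mul]
    norm_num
  · obtain ⟨l, hl, hl0⟩ : ∃ l ∈ Finset.range k, z' (l + 1) ≠ 0 := by
      by_contra hcon
      push Not at hcon
      have : sqSum k z' = 0 := Finset.sum_eq_zero fun j hj => by simp [hcon j hj]
      linarith
    rw [Finset.mem_range] at hl
    exact h.firstRow_ne_zero hA hB hs' (key z' hs' hnn) (fun j h1 h2 => hnn j h1 h2.le)
      (l := l + 1) (by omega) (by omega) hl0

end

end

/-! ### The Cholesky factorization and the main loop -/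

section

variable {n : ℕ}

/-- The entry `R (j - 2) j` of the Cholesky factor, which the memory does not keep. -/
def State.r2 (s : State n) (j : ℕ) : ℝ := s.d (j - 2) * s.f j / s.r0 (j - 2)

/-- The entry `R (k - 1) k` that the `k`-th Cholesky step computes. -/
def cholEntry (k : ℕ) (s : State n) : ℝ :=
  (s.d (k - 1) * s.e k + s.e (k - 1) * s.f k - s.r1 (k - 1) * s.r2 k) / s.r0 (k - 1)

/-- The pivot of the `k`-th Cholesky step. -/
def cholPivot (ε : ℝ) (k : ℕ) (s : State n) : ℝ :=
  s.d k * s.d k + s.e k * s.e k + s.f k * s.f k - ε * ε - cholEntry k s * cholEntry k s -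
    s.r2 k * s.r2 k

open Classical in
/-- The result of the `k`-th Cholesky step. -/
def cholNext (ε : ℝ) (k : ℕ) (s : State n) : State n × Bool :=
  if 0 < cholPivot ε k s then
    ({ s with
      r0 := Function.update s.r0 k (Real.sqrt (cholPivot ε k s))
      r1 := Function.update s.r1 k (cholEntry k s) }, true)
  else (s, false)

theorem det_choleskyStep (A : Matrix (Fin n) (Fin n) ℝ) (TA : ℕ) (ε : ℝ) (k : ℕ) (s : State n) :
    Prog.Det A TA (choleskyStep ε k s) (cholNext ε k s) 21 := by
  refine Prog.Det.mono ?_ (c := 1 + (1 + (1 + (1 + (1 + (1 + (1 + (1 + (1 + (1 + (1 + (1 + (1 +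
    (1 + (1 + (1 + (1 + (1 + (1 + (1 + 1)))))))))))))))))))) (by omega)
  refine (Prog.det_mulP _ _).bind ?_
  refine (Prog.det_mulP _ _).bind ?_
  refine (Prog.det_mulP _ _).bind ?_
  refine (Prog.det_addP _ _).bind ?_
  refine (Prog.det_mulP _ _).bind ?_
  refine (Prog.det_mulP _ _).bind ?_
  refine (Prog.det_mulP _ _).bind ?_
  refine (Prog.det_addP _ _).bind ?_
  refine (Prog.det_addP _ _).bind ?_
  refine (Prog.det_divP _ _).bind ?_
  refine (Prog.det_mulP _ _).bind ?_
  refine (Prog.det_subP _ _).bind ?_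
  refine (Prog.det_divP _ _).bind ?_
  refine (Prog.det_mulP _ _).bind ?_
  refine (Prog.det_subP _ _).bind ?_
  refine (Prog.det_mulP _ _).bind ?_
  refine (Prog.det_mulP _ _).bind ?_
  refine (Prog.det_subP _ _).bind ?_
  refine (Prog.det_subP _ _).bind ?_
  refine (Prog.det_lessP _ _).bind ?_
  exact Prog.Det.ite (P := 0 < cholPivot ε k s)
    (fun _ => Prog.Det.mono (c := 1 + 0)
      (by refine (Prog.det_sqrtP _).bind ?_; exact Prog.det_pure _) le_rfl)
    (fun _ => (Prog.det_pure _).mono (by omega))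

/-- The memory holds the first `k` columns of the Cholesky factor of `T'ᵀ T' - ε² I`. -/
structure IsChol (ε : ℝ) (k : ℕ) (s : State n) : Prop where
  r0_zero : s.r0 0 = 1
  r1_zero : s.r1 0 = 0
  pos : ∀ j, 1 ≤ j → j ≤ k → 0 < s.r0 j
  diag : ∀ j, 1 ≤ j → j ≤ k →
    s.d j ^ 2 + s.e j ^ 2 + s.f j ^ 2 - ε ^ 2 = s.r0 j ^ 2 + s.r1 j ^ 2 + s.r2 j ^ 2
  sup : ∀ j, 1 ≤ j → j ≤ k →
    s.d (j - 1) * s.e j + s.e (j - 1) * s.f j = s.r0 (j - 1) * s.r1 j + s.r1 (j - 1) * s.r2 j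

section

variable {A : Matrix (Fin n) (Fin n) ℝ} {b : Fin n → ℝ} {k : ℕ} {s s' : State n} {ε : ℝ}

theorem IsLanczos.congr (h : IsLanczos A b k s) (hq : s'.q = s.q) (hα : s'.α = s.α)
    (hβ : s'.β = s.β) : IsLanczos A b k s' := by
  constructor <;> simp only [hq, hα, hβ]
  exacts [h.q_zero, h.q_one, h.recur, h.pos, h.nonneg, h.orth, h.norm, h.norm_last]

theorem isBand_init (q1 : Fin n → ℝ) : IsBand 0 (initState q1) :=
  ⟨rfl, rfl, rfl, fun j h1 h2 => by omega, fun j h1 h2 => by omega, fun j h1 h2 => by omega⟩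

theorem isChol_init (ε : ℝ) (q1 : Fin n → ℝ) : IsChol ε 0 (initState q1) :=
  ⟨by simp [initState], rfl, fun j h1 h2 => by omega, fun j h1 h2 => by omega,
    fun j h1 h2 => by omega⟩

theorem IsBand.step (hB : IsBand k s) : IsBand (k + 1) (lanczosNext A (k + 1) s) := by
  refine ⟨?_, ?_, ?_, fun j h1 h2 => ?_, fun j h1 h2 => ?_, fun j h1 h2 => ?_⟩
  · simp only [lanczosNext]
    rw [Function.update_of_ne (by omega), hB.d_zero]
  · simp only [lanczosNext]
    rw [Function.update_of_ne (by omega), hB.e_zero]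
  · by_cases h : 2 = k + 1
    · simp only [lanczosNext, h, Function.update_self]
      exact if_neg (by omega)
    · exact (Function.update_of_ne h _ _).trans hB.f_two
  all_goals
    rcases Nat.lt_or_ge j (k + 1) with h3 | h3
    · simp only [lanczosNext]
      rw [Function.update_of_ne (by omega), Function.update_of_ne (by omega)]
      first
      | exact hB.d_eq j h1 (by omega)
      | exact hB.e_eq j h1 (by omega)
      | exact hB.f_eq j h1 (by omega)
    · obtain rfl : j = k + 1 := by omega
      simp [lanczosNext]

theorem IsChol.lanczosNext (hC : IsChol ε k s) :
    IsChol ε k (Minberr.lanczosNext A (k + 1) s) := by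
  have hd : ∀ j, j ≤ k → (Minberr.lanczosNext A (k + 1) s).d j = s.d j := fun j hj =>
    Function.update_of_ne (by omega) _ _
  have he : ∀ j, j ≤ k → (Minberr.lanczosNext A (k + 1) s).e j = s.e j := fun j hj =>
    Function.update_of_ne (by omega) _ _
  have hf : ∀ j, j ≤ k → (Minberr.lanczosNext A (k + 1) s).f j = s.f j := fun j hj =>
    Function.update_of_ne (by omega) _ _
  have h0 : (Minberr.lanczosNext A (k + 1) s).r0 = s.r0 := rfl
  have h1 : (Minberr.lanczosNext A (k + 1) s).r1 = s.r1 := rfl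
  have h2 : ∀ j, j ≤ k → (Minberr.lanczosNext A (k + 1) s).r2 j = s.r2 j := fun j hj => by
    rw [State.r2, State.r2, hd _ (by omega), hf _ hj, h0]
  refine ⟨hC.r0_zero, hC.r1_zero, hC.pos, fun j i1 i2 => ?_, fun j i1 i2 => ?_⟩
  · rw [hd j i2, he j i2, hf j i2, h0, h1, h2 j i2]
    exact hC.diag j i1 i2
  · rw [hd _ (by omega), he j i2, he _ (by omega), hf j i2, h0, h1, h2 j i2]
    exact hC.sup j i1 i2

theorem IsChol.r0_pos (hC : IsChol ε k s) {j : ℕ} (hj : j ≤ k) : 0 < s.r0 j := by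
  rcases Nat.eq_zero_or_pos j with rfl | h
  · rw [hC.r0_zero]; exact one_pos
  · exact hC.pos j h hj

theorem IsChol.sup_next (hC : IsChol ε k s) :
    s.d k * s.e (k + 1) + s.e k * s.f (k + 1) =
      s.r0 k * cholEntry (k + 1) s + s.r1 k * s.r2 (k + 1) := by
  have := (hC.r0_pos (le_refl k)).ne'
  rw [cholEntry, Nat.add_sub_cancel]
  field_simp
  ring

/-- Completing squares: the quadratic form of `T'ᵀ T' - ε² I` after `k + 1` steps. The matrix `R`
on the right gets `0` in place of the square root of the pivot. -/
theorem IsChol.sum_mul_sq (hC : IsChol ε k s) (hB : IsBand (k + 1) s) {z : ℕ → ℝ}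
    (hz : SuppOn (k + 1) z) :
    sqSum (k + 1) (s.mul z) - ε ^ 2 * sqSum (k + 1) z =
      ∑ j ∈ Finset.range (k + 1), upperMul (Function.update s.r0 (k + 1) 0)
        (Function.update s.r1 (k + 1) (cholEntry (k + 1) s)) s.r2 z (j + 1) ^ 2 +
      cholPivot ε (k + 1) s * z (k + 1) ^ 2 := by
  have hold : ∀ (g : ℕ → ℝ) (x : ℝ) j, j ≤ k → Function.update g (k + 1) x j = g j :=
    fun g x j hj => Function.update_of_ne (by omega) _ _
  have hr2 : ∀ j, j ≤ 2 → s.r2 j = 0 := fun j hj => by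
    rw [State.r2, Nat.sub_eq_zero_of_le hj, hB.d_zero, zero_mul, zero_div]
  have he1 : s.e 1 = 0 := by rw [hB.e_eq 1 le_rfl (by omega), if_neg (by omega)]
  have hf1 : s.f 1 = 0 := by rw [hB.f_eq 1 le_rfl (by omega), if_neg (by omega)]
  have hsup : ∀ j, 1 ≤ j → j ≤ k + 1 → s.d (j - 1) * s.e j + s.e (j - 1) * s.f j =
      Function.update s.r0 (k + 1) 0 (j - 1) *
        Function.update s.r1 (k + 1) (cholEntry (k + 1) s) j +
      Function.update s.r1 (k + 1) (cholEntry (k + 1) s) (j - 1) * s.r2 j := by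
    intro j h1 h2
    rw [hold _ _ (j - 1) (by omega), hold _ _ (j - 1) (by omega)]
    rcases Nat.lt_or_ge j (k + 1) with h3 | h3
    · rw [hold _ _ j (by omega)]
      exact hC.sup j h1 (by omega)
    · obtain rfl : j = k + 1 := by omega
      rw [Function.update_self, Nat.add_sub_cancel]
      exact hC.sup_next
  have hr11 : Function.update s.r1 (k + 1) (cholEntry (k + 1) s) 1 = 0 := by
    have := hsup 1 le_rfl (by omega)
    rw [Nat.sub_self, hold _ _ 0 (by omega), hold _ _ 0 (by omega), hC.r0_zero, hC.r1_zero,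
      he1, hf1] at this
    simpa using this.symm
  refine sum_upperMul_sq_sub ⟨hB.e_zero, he1⟩ ⟨hf1, hB.f_two⟩
    ⟨(hold _ _ 0 (by omega)).trans hC.r1_zero, hr11⟩ ⟨hr2 1 (by omega), hr2 2 le_rfl⟩ hz ?_
    hsup ?_
  · intro j h1 h2
    rcases Nat.lt_or_ge j (k + 1) with h3 | h3
    · rw [hold _ _ j (by omega), hold _ _ j (by omega), if_neg (by omega), add_zero]
      exact hC.diag j h1 (by omega)
    · obtain rfl : j = k + 1 := by omega
      rw [Function.update_self, Function.update_self, if_pos rfl, cholPivot]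
      ring
  · intro j h1 h2
    rw [hold _ _ (j - 2) (by omega), State.r2, mul_div_cancel₀ _ (hC.r0_pos (by omega)).ne']

/-- A nonpositive pivot yields a vector `z` with `‖T' z‖ ≤ ε ‖z‖`. -/
theorem IsChol.exists_small (hC : IsChol ε k s) (hB : IsBand (k + 1) s)
    (hp : cholPivot ε (k + 1) s ≤ 0) :
    ∃ z, SuppOn (k + 1) z ∧ z (k + 1) = 1 ∧
      sqSum (k + 1) (s.mul z) ≤ ε ^ 2 * sqSum (k + 1) z := by
  set r0' := Function.update s.r0 (k + 1) 0 with hr0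
  set r1' := Function.update s.r1 (k + 1) (cholEntry (k + 1) s)
  have hz := nullVec_suppOn r0' r1' s.r2 (k := k + 1) (by omega)
  have hl := nullVec_last r0' r1' s.r2 (k := k + 1) (by omega)
  refine ⟨nullVec r0' r1' s.r2 (k + 1), hz, hl, ?_⟩
  have h := hC.sum_mul_sq hB hz
  have h0 : ∑ j ∈ Finset.range (k + 1),
      upperMul r0' r1' s.r2 (nullVec r0' r1' s.r2 (k + 1)) (j + 1) ^ 2 = 0 := by
    refine Finset.sum_eq_zero fun j hj => ?_
    rw [Finset.mem_range] at hj
    have : upperMul r0' r1' s.r2 (nullVec r0' r1' s.r2 (k + 1)) (j + 1) = 0 := by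
      rcases Nat.lt_or_ge j k with h3 | h3
      · refine upperMul_nullVec (fun l h1 h2 => ?_) (by omega) (by omega)
        rw [hr0, Function.update_of_ne (by omega)]
        exact (hC.r0_pos (by omega)).ne'
      · obtain rfl : j = k := by omega
        rw [upperMul, hz (j + 1 + 1) (Or.inr (by omega)), hz (j + 1 + 2) (Or.inr (by omega)), hr0,
          Function.update_self]
        ring
    rw [this]; norm_num
  rw [h0, hl] at h
  linarith

/-- If `T'` is singular then the pivot is not positive. -/
theorem IsChol.d_ne_zero (hC : IsChol ε k s) (hB : IsBand (k + 1) s)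
    (hL : IsLanczos A b (k + 1) s) (hp : 0 < cholPivot ε (k + 1) s) : s.d (k + 1) ≠ 0 := by
  intro hd
  have hz := nullVec_suppOn s.d s.e s.f (k := k + 1) (by omega)
  have hl := nullVec_last s.d s.e s.f (k := k + 1) (by omega)
  have h := hC.sum_mul_sq hB hz
  have h0 : sqSum (k + 1) (s.mul (nullVec s.d s.e s.f (k + 1))) = 0 := by
    refine Finset.sum_eq_zero fun j hj => ?_
    rw [Finset.mem_range] at hj
    have : s.mul (nullVec s.d s.e s.f (k + 1)) (j + 1) = 0 := by
      rcases Nat.lt_or_ge j k with h3 | h3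
      · refine upperMul_nullVec (fun l h1 h2 => ?_) (by omega) (by omega)
        rw [hB.d_eq l h1 (by omega)]
        exact (hL.pos _ (by omega) (by omega)).ne'
      · obtain rfl : j = k := by omega
        rw [State.mul, upperMul, hz (j + 1 + 1) (Or.inr (by omega)),
          hz (j + 1 + 2) (Or.inr (by omega)), hd]
        ring
    rw [this]; norm_num
  have h1 := sqSum_nonneg (k + 1) (nullVec s.d s.e s.f (k + 1))
  have h2 : 0 ≤ ∑ j ∈ Finset.range (k + 1), upperMul (Function.update s.r0 (k + 1) 0)
        (Function.update s.r1 (k + 1) (cholEntry (k + 1) s)) s.r2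
        (nullVec s.d s.e s.f (k + 1)) (j + 1) ^ 2 := Finset.sum_nonneg fun _ _ => sq_nonneg _
  rw [h0, hl] at h
  nlinarith [mul_nonneg (sq_nonneg ε) h1]

theorem IsChol.step (hC : IsChol ε k s) (hp : 0 < cholPivot ε (k + 1) s) :
    IsChol ε (k + 1) (cholNext ε (k + 1) s).1 := by
  have e : cholNext ε (k + 1) s = _ := if_pos hp
  have hold : ∀ (g : ℕ → ℝ) (x : ℝ) j, j ≤ k → Function.update g (k + 1) x j = g j :=
    fun g x j hj => Function.update_of_ne (by omega) _ _
  rw [e]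
  set s' : State n := { s with
      r0 := Function.update s.r0 (k + 1) (Real.sqrt (cholPivot ε (k + 1) s))
      r1 := Function.update s.r1 (k + 1) (cholEntry (k + 1) s) } with hs'
  have h2 : ∀ j, j ≤ k + 1 → s'.r2 j = s.r2 j := fun j hj => by
    simp only [State.r2, hs']
    rw [hold _ _ (j - 2) (by omega)]
  change IsChol ε (k + 1) s'
  refine ⟨(hold s.r0 (Real.sqrt (cholPivot ε (k + 1) s)) 0 (by omega)).trans hC.r0_zero,
    (hold s.r1 (cholEntry (k + 1) s) 0 (by omega)).trans hC.r1_zero, fun j i1 i2 => ?_,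
    fun j i1 i2 => ?_, fun j i1 i2 => ?_⟩
  · simp only [hs']
    rcases Nat.lt_or_ge j (k + 1) with h3 | h3
    · rw [hold _ _ j (by omega)]
      exact hC.pos j i1 (by omega)
    · obtain rfl : j = k + 1 := by omega
      rw [Function.update_self]
      exact Real.sqrt_pos.2 hp
  · rw [h2 j i2]
    simp only [hs']
    rcases Nat.lt_or_ge j (k + 1) with h3 | h3
    · rw [hold _ _ j (by omega), hold _ _ j (by omega)]
      exact hC.diag j i1 (by omega)
    · obtain rfl : j = k + 1 := by omega
      rw [Function.update_self, Function.update_self, Real.sq_sqrt hp.le, cholPivot]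
      ring
  · rw [h2 j i2]
    simp only [hs']
    rw [hold _ _ (j - 1) (by omega), hold _ _ (j - 1) (by omega)]
    rcases Nat.lt_or_ge j (k + 1) with h3 | h3
    · rw [hold _ _ j (by omega)]
      exact hC.sup j i1 (by omega)
    · obtain rfl : j = k + 1 := by omega
      rw [Function.update_self, Nat.add_sub_cancel]
      exact hC.sup_next

/-- The main loop: its result does not depend on the draws, it satisfies the Lanczos relations, and
if it ends early then the breakdown gives a vector `z` with `‖T' z‖ ≤ ε ‖z‖`. -/
theorem exists_det_mainLoop (hA : A.IsSymm) (m : ℕ) (hL : IsLanczos A b k s)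
    (hB : IsBand k s) (hC : IsChol ε k s) (hβ : 0 < s.β (k + 1)) :
    ∃ (i : ℕ) (t : State n), i ≤ m ∧ (1 ≤ m → 1 ≤ i) ∧
      (∀ TA, Prog.Det A TA (mainLoop ε m k s) (k + i, t) (i * (TA + 9 * n + 22))) ∧
      IsLanczos A b (k + i) t ∧ IsBand (k + i) t ∧
      (i = m ∨ ∃ z, SuppOn (k + i) z ∧ z (k + i) = 1 ∧
        sqSum (k + i) (t.mul z) ≤ ε ^ 2 * sqSum (k + i) z) := by
  induction m generalizing k s with
  | zero =>
    exact ⟨0, s, le_rfl, fun h => h, fun TA => (Prog.det_pure _).mono (by omega), hL, hB,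
      Or.inl rfl⟩
  | succ m ih =>
    have hL1 := hL.step hA hβ
    have hB1 := hB.step (A := A)
    have hC1 := hC.lanczosNext (A := A)
    set s1 := lanczosNext A (k + 1) s with hs1
    by_cases hp : 0 < cholPivot ε (k + 1) s1
    · have e : cholNext ε (k + 1) s1 = _ := if_pos hp
      have hC2 := hC1.step hp
      have hd := hC1.d_ne_zero hB1 hL1 hp
      have hL2 : IsLanczos A b (k + 1) (cholNext ε (k + 1) s1).1 := by
        rw [e]; exact hL1.congr rfl rfl rfl
      have hB2 : IsBand (k + 1) (cholNext ε (k + 1) s1).1 := by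
        rw [e]; exact ⟨hB1.1, hB1.2, hB1.3, hB1.4, hB1.5, hB1.6⟩
      have hβ2 : 0 < (cholNext ε (k + 1) s1).1.β (k + 1 + 1) := by
        rw [hB1.d_eq _ (by omega) le_rfl] at hd
        rw [e]
        exact hL1.nonneg.lt_of_ne' hd
      obtain ⟨i, t, h1, -, h3, h4, h5, h6⟩ := ih hL2 hB2 hC2 hβ2
      have ek : k + 1 + i = k + (i + 1) := by omega
      rw [ek] at h3 h4 h5 h6
      refine ⟨i + 1, t, by omega, fun _ => by omega, fun TA => ?_, h4, h5, ?_⟩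
      · refine Prog.Det.mono ?_ (c := (TA + 9 * n + 1) + (21 + i * (TA + 9 * n + 22)))
          (by rw [add_mul]; omega)
        refine (det_lanczosStep A TA (k + 1) s).bind ((det_choleskyStep A TA ε (k + 1) s1).bind ?_)
        have h2 : (cholNext ε (k + 1) s1).2 = true := by rw [e]
        rw [if_pos h2]
        exact h3 TA
      · rcases h6 with h6 | h6
        · exact Or.inl (by omega)
        · exact Or.inr h6
    · have e : cholNext ε (k + 1) s1 = _ := if_neg hp
      refine ⟨1, s1, by omega, fun _ => le_rfl, fun TA => ?_, hL1, hB1,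
        Or.inr (hC1.exists_small hB1 (not_lt.1 hp))⟩
      refine Prog.Det.mono ?_ (c := (TA + 9 * n + 1) + (21 + 0)) (by omega)
      refine (det_lanczosStep A TA (k + 1) s).bind ((det_choleskyStep A TA ε (k + 1) s1).bind ?_)
      rw [e]
      exact Prog.det_pure _

end

end

/-! ### Inverse iteration for the smallest singular value -/

section

variable {E : Type*} [NormedAddCommGroup E] [InnerProductSpace ℝ E] [FiniteDimensional ℝ E]

/-- The Gram operator `Tᵀ T`. -/
def gram (T : E →ₗ[ℝ] E) : E →ₗ[ℝ] E := LinearMap.adjoint T ∘ₗ T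

theorem inner_gram (T : E →ₗ[ℝ] E) (x y : E) : inner ℝ x (gram T y) = inner ℝ (T x) (T y) := by
  rw [gram, LinearMap.comp_apply, LinearMap.adjoint_inner_right]

theorem gram_pow_symm (T : E →ₗ[ℝ] E) (N : ℕ) (x y : E) :
    inner ℝ x ((gram T ^ N) y) = inner ℝ ((gram T ^ N) x) y := by
  have hs : ∀ x y, inner ℝ x (gram T y) = inner ℝ (gram T x) y := fun x y =>
    (LinearMap.isSymmetric_adjoint_comp_self T x y).symm
  induction N generalizing x y with
  | zero => rfl
  | succ N ih =>
    conv_lhs => rw [pow_succ', Module.End.mul_apply, hs, ih]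
    rw [pow_succ, Module.End.mul_apply]

theorem gram_injective {T : E →ₗ[ℝ] E} (hT : Function.Injective T) :
    Function.Injective (gram T) := by
  rw [injective_iff_map_eq_zero]
  intro x hx
  have : inner ℝ (T x) (T x) = 0 := by rw [← inner_gram, hx, inner_zero_right]
  exact (injective_iff_map_eq_zero T).1 hT x (inner_self_eq_zero.1 this)

/-- The squared weight that `N` steps of inverse iteration leave, relative to the weight on the
smallest singular value, on the singular values too large for the factor `3 / 2`. -/
def decay (N : ℕ) : ℝ := 1 / 9 * (4 / 9) ^ (2 * N - 2)

theorem decay_bound {N : ℕ} (hN : 1 ≤ N) {r : ℝ} (h0 : 0 ≤ r) :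
    r ^ (2 * N - 1) * (1 - 9 / 4 * r) ≤ decay N := by
  obtain ⟨M, rfl⟩ : ∃ M, N = M + 1 := ⟨N - 1, by omega⟩
  have e1 : 2 * (M + 1) - 1 = 2 * M + 1 := by omega
  have e2 : 2 * (M + 1) - 2 = 2 * M := by omega
  rw [decay, e1, e2]
  rcases le_total r (4 / 9) with h | h
  · have h1 : r * (1 - 9 / 4 * r) ≤ 1 / 9 := by nlinarith [sq_nonneg (r - 2 / 9)]
    have h2 : r ^ (2 * M) ≤ (4 / 9) ^ (2 * M) := pow_le_pow_left₀ h0 h _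
    calc r ^ (2 * M + 1) * (1 - 9 / 4 * r) = (r * (1 - 9 / 4 * r)) * r ^ (2 * M) := by ring
      _ ≤ 1 / 9 * r ^ (2 * M) := by gcongr
      _ ≤ 1 / 9 * (4 / 9) ^ (2 * M) := by gcongr
  · have h1 : r ^ (2 * M + 1) * (1 - 9 / 4 * r) ≤ 0 :=
      mul_nonpos_of_nonneg_of_nonpos (by positivity) (by linarith)
    exact h1.trans (by positivity)

/-- The smallest singular value `σ` of an injective `T`, a right singular vector `u` for it, and the
effect of inverse iteration: if `g` has enough weight on `u`, then `w = (Tᵀ T)⁻ᴺ g` satisfies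
`‖T w‖ ≤ 3 / 2 * σ * ‖w‖`. -/
theorem exists_smallest_singular [Nontrivial E] (T : E →ₗ[ℝ] E) (hT : Function.Injective T) :
    ∃ (σ : ℝ) (u : E), 0 < σ ∧ ‖u‖ = 1 ∧ ‖T u‖ = σ ∧ (∀ v, σ * ‖v‖ ≤ ‖T v‖) ∧
      ∀ N, 1 ≤ N → ∀ w, decay N * ‖(gram T ^ N) w‖ ^ 2 ≤
        5 / 4 * inner ℝ u ((gram T ^ N) w) ^ 2 → ‖T w‖ ≤ 3 / 2 * (σ * ‖w‖) := by
  have hsym : (gram T).IsSymmetric := LinearMap.isSymmetric_adjoint_comp_self T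
  set B := hsym.eigenvectorBasis rfl
  set l := hsym.eigenvalues rfl
  have hB : ∀ i, gram T (B i) = l i • B i := fun i => hsym.apply_eigenvectorBasis rfl i
  have hl : ∀ i, l i = ‖T (B i)‖ ^ 2 := fun i => by
    have h := inner_gram T (B i) (B i)
    rw [hB, inner_smul_right, real_inner_self_eq_norm_sq, real_inner_self_eq_norm_sq,
      B.norm_eq_one] at h
    linarith
  have hlpos : ∀ i, 0 < l i := fun i => by
    rw [hl]
    have : T (B i) ≠ 0 := fun h => by
      have := (injective_iff_map_eq_zero T).1 hT _ h
      have h1 := B.norm_eq_one i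
      rw [this, norm_zero] at h1
      exact zero_ne_one h1
    positivity
  have hnorm : ∀ w, ‖w‖ ^ 2 = ∑ i, inner ℝ (B i) w ^ 2 := fun w => by
    rw [← B.sum_sq_norm_inner_right w]
    exact Finset.sum_congr rfl fun i _ => by rw [Real.norm_eq_abs, sq_abs]
  have hTnorm : ∀ w, ‖T w‖ ^ 2 = ∑ i, l i * inner ℝ (B i) w ^ 2 := fun w => by
    rw [← real_inner_self_eq_norm_sq, ← inner_gram, ← B.sum_inner_mul_inner]
    refine Finset.sum_congr rfl fun i _ => ?_
    rw [← hsym (B i) w, hB, inner_smul_left, real_inner_comm]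
    simp only [conj_trivial]
    ring
  have hpow : ∀ N i w, inner ℝ (B i) ((gram T ^ N) w) = l i ^ N * inner ℝ (B i) w := by
    intro N i w
    induction N with
    | zero => simp
    | succ N ih =>
      rw [pow_succ', Module.End.mul_apply, ← hsym (B i), hB, inner_smul_left, ih]
      simp only [conj_trivial]
      ring
  have : Nonempty (Fin (Module.finrank ℝ E)) := ⟨⟨0, Module.finrank_pos⟩⟩
  obtain ⟨i0, hi0⟩ := Finite.exists_min l
  refine ⟨‖T (B i0)‖, B i0, ?_, B.norm_eq_one i0, rfl, ?_, ?_⟩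
  · have := hlpos i0
    rw [hl] at this
    exact lt_of_le_of_ne (norm_nonneg _) fun h => by rw [← h] at this; norm_num at this
  · intro v
    refine le_of_sq_le_sq ?_ (norm_nonneg _)
    rw [mul_pow, ← hl, hnorm, hTnorm, Finset.mul_sum]
    exact Finset.sum_le_sum fun i _ => by gcongr; exact hi0 i
  · intro N hN w hw
    refine le_of_sq_le_sq ?_ (by positivity)
    have h0 := hlpos i0
    obtain ⟨M, rfl⟩ : ∃ M, N = M + 1 := ⟨N - 1, by omega⟩
    have e1 : 2 * (M + 1) - 1 = 2 * M + 1 := by omega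
    set c := l i0 ^ (2 * M + 1) with hc
    have hcpos : 0 < c := by positivity
    -- each term in eigencoordinates, scaled by a power of the smallest eigenvalue
    have hterm : ∀ i, c * (l i * inner ℝ (B i) w ^ 2 - 9 / 4 * l i0 * inner ℝ (B i) w ^ 2) =
        (l i0 / l i) ^ (2 * M + 1) * (1 - 9 / 4 * (l i0 / l i)) *
          inner ℝ (B i) ((gram T ^ (M + 1)) w) ^ 2 := by
      intro i
      have hr : l i0 = l i0 / l i * l i := by rw [div_mul_cancel₀ _ (hlpos i).ne']
      rw [hpow, hc]
      generalize l i0 / l i = r at hr ⊢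
      rw [hr]
      ring
    have hsum : c * (‖T w‖ ^ 2 - 9 / 4 * l i0 * ‖w‖ ^ 2) ≤
        decay (M + 1) * ‖(gram T ^ (M + 1)) w‖ ^ 2 -
          5 / 4 * inner ℝ (B i0) ((gram T ^ (M + 1)) w) ^ 2 := by
      rw [hTnorm, hnorm w, hnorm ((gram T ^ (M + 1)) w), Finset.mul_sum, Finset.mul_sum,
        ← Finset.sum_sub_distrib, Finset.mul_sum]
      have hsplit : ∑ i, (decay (M + 1) * inner ℝ (B i) ((gram T ^ (M + 1)) w) ^ 2 -
          if i = i0 then 5 / 4 * inner ℝ (B i0) ((gram T ^ (M + 1)) w) ^ 2 else 0) =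
          ∑ i, decay (M + 1) * inner ℝ (B i) ((gram T ^ (M + 1)) w) ^ 2 -
            5 / 4 * inner ℝ (B i0) ((gram T ^ (M + 1)) w) ^ 2 := by
        rw [Finset.sum_sub_distrib, Finset.sum_ite_eq', if_pos (Finset.mem_univ _)]
      rw [← hsplit]
      refine Finset.sum_le_sum fun i _ => ?_
      rw [hterm]
      by_cases hi : i = i0
      · subst hi
        rw [if_pos rfl, div_self h0.ne', one_pow]
        have : 0 ≤ decay (M + 1) := by unfold decay; positivity
        nlinarith [mul_nonneg this (sq_nonneg (inner ℝ (B i) ((gram T ^ (M + 1)) w)))]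
      · rw [if_neg hi, sub_zero]
        have := decay_bound (N := M + 1) (by omega) (div_nonneg h0.le (hlpos i).le)
        rw [e1] at this
        gcongr
    have hle : c * (‖T w‖ ^ 2 - 9 / 4 * l i0 * ‖w‖ ^ 2) ≤ 0 := hsum.trans (by linarith)
    have := nonpos_of_mul_nonpos_right hle hcpos
    rw [mul_pow, mul_pow, ← hl]
    linarith

end

/-- The bound on the squared weights left by `N` steps, `N ≥ 2.23 log (k / δ²)`. -/
theorem decay_le {k N : ℕ} {δ : ℝ} (hk : 1 ≤ k) (h0 : 0 < δ) (hδ : δ < 1) (hN : 1 ≤ N)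
    (h : 2.23 * Real.log (k / (δ * δ)) ≤ N) : decay N * (5 * k / δ) ≤ 5 / 4 * δ ^ 2 := by
  have hk' : (1 : ℝ) ≤ k := by exact_mod_cast hk
  set x : ℝ := k / (δ * δ) with hx
  have hxp : 0 < x := by positivity
  have hx1 : 1 ≤ x := by
    rw [hx, le_div_iff₀ (by positivity)]
    nlinarith
  have hL : 0 ≤ Real.log x := Real.log_nonneg hx1
  have hlog : (0.69 : ℝ) ≤ Real.log (9 / 4) :=
    (by linarith [Real.log_two_gt_d9] : (0.69 : ℝ) ≤ Real.log 2).trans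
      (Real.log_le_log (by norm_num) (by norm_num))
  -- `4.46 * log (9 / 4) ≥ 3`
  have hpow : x ^ 3 ≤ (9 / 4 : ℝ) ^ (2 * N) := by
    rw [← Real.log_le_log_iff (by positivity) (by positivity), Real.log_pow, Real.log_pow]
    push_cast
    have : (2.23 * Real.log x) * 0.69 ≤ N * Real.log (9 / 4) := by gcongr
    nlinarith
  have hdec : decay N = 9 / 16 * ((9 / 4 : ℝ) ^ (2 * N))⁻¹ := by
    obtain ⟨M, rfl⟩ : ∃ M, N = M + 1 := ⟨N - 1, by omega⟩
    have e : 2 * (M + 1) - 2 = 2 * M := by omega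
    have e3 : (4 / 9 : ℝ) = (9 / 4)⁻¹ := by norm_num
    rw [decay, e, e3, inv_pow, show 2 * (M + 1) = 2 * M + 2 by ring, pow_add, mul_inv]
    ring
  have h9 : decay N ≤ 1 / 9 := by
    rw [decay]
    have : (4 / 9 : ℝ) ^ (2 * N - 2) ≤ 1 := pow_le_one₀ (by norm_num) (by norm_num)
    linarith
  have hx3 : decay N ≤ 9 / 16 * (x ^ 3)⁻¹ := by
    rw [hdec]
    gcongr
  suffices H : decay N ≤ δ ^ 3 / (4 * k) by
    calc decay N * (5 * k / δ) ≤ δ ^ 3 / (4 * k) * (5 * k / δ) := by gcongr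
      _ = 5 / 4 * δ ^ 2 := by field_simp
  by_cases hc : 9 * δ ^ 3 ≤ 4 * (k : ℝ) ^ 2
  · refine hx3.trans ?_
    rw [hx, div_pow, inv_div, le_div_iff₀ (by positivity), ← mul_div_assoc, div_mul_eq_mul_div,
      div_le_iff₀ (by positivity)]
    have : 0 ≤ δ ^ 3 * k * (4 * (k : ℝ) ^ 2 - 9 * δ ^ 3) :=
      mul_nonneg (by positivity) (by linarith)
    nlinarith
  · -- this happens only for `k = 1`
    push Not at hc
    have hδ3 : δ ^ 3 < 1 := pow_lt_one₀ h0.le hδ (by norm_num)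
    have hk1 : k = 1 := by
      by_contra hne
      have : (2 : ℝ) ≤ k := by exact_mod_cast (by omega : 2 ≤ k)
      nlinarith
    subst hk1
    refine h9.trans ?_
    norm_num at hc ⊢
    linarith

/-! ### Gaussian estimates -/

theorem gaussianReal_abs_le (δ : ℝ) :
    gaussianReal 0 1 {x | |x| ≤ δ} ≤ ENNReal.ofReal (4 / 5 * δ) := by
  have hpdf : ∀ x, gaussianPDF 0 1 x ≤ ENNReal.ofReal (2 / 5) := by
    intro x
    refine ENNReal.ofReal_le_ofReal ?_
    have h1 : Real.exp (-(x - 0) ^ 2 / (2 * (1 : NNReal))) ≤ 1 := by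
      rw [Real.exp_le_one_iff]
      have := sq_nonneg (x - 0)
      simp only [NNReal.coe_one]
      linarith
    have h2 : (Real.sqrt (2 * Real.pi * (1 : NNReal)))⁻¹ ≤ 2 / 5 := by
      have h3 : (5 / 2 : ℝ) ≤ Real.sqrt (2 * Real.pi * (1 : NNReal)) := by
        refine Real.le_sqrt_of_sq_le ?_
        simp only [NNReal.coe_one]
        linarith [Real.pi_gt_d2]
      calc _ ≤ (5 / 2 : ℝ)⁻¹ := inv_anti₀ (by norm_num) h3
        _ = 2 / 5 := by norm_num
    rw [gaussianPDFReal]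
    calc _ ≤ (2 / 5 : ℝ) * 1 := by gcongr
      _ = 2 / 5 := by norm_num
  have hset : {x : ℝ | |x| ≤ δ} = Set.Icc (-δ) δ := by
    ext x; simp [abs_le]
  rw [gaussianReal_apply 0 one_ne_zero, hset]
  calc ∫⁻ x in Set.Icc (-δ) δ, gaussianPDF 0 1 x
      ≤ ∫⁻ _ in Set.Icc (-δ) δ, ENNReal.ofReal (2 / 5) := lintegral_mono fun x => hpdf x
    _ = ENNReal.ofReal (4 / 5 * δ) := by
      rw [setLIntegral_const, Real.volume_Icc, ← ENNReal.ofReal_mul (by norm_num)]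
      congr 1; ring

theorem lintegral_sq_gaussianReal :
    ∫⁻ x, ENNReal.ofReal (x ^ 2) ∂gaussianReal 0 1 = 1 := by
  have hi : Integrable (fun x : ℝ => x ^ 2) (gaussianReal 0 1) :=
    (memLp_id_gaussianReal (μ := 0) (v := 1) 2).integrable_sq
  rw [← ofReal_integral_eq_lintegral_ofReal hi (ae_of_all _ fun x => sq_nonneg x)]
  have h := variance_fun_id_gaussianReal (μ := 0) (v := 1)
  rw [variance_eq_integral (by fun_prop)] at h
  simp only [integral_id_gaussianReal, sub_zero, NNReal.coe_one] at h
  rw [h, ENNReal.ofReal_one]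

section

variable {Ω : Type*} [MeasurableSpace Ω] {P : Measure Ω} {k : ℕ}
  {g : ℕ → Ω → ℝ}

/-- A linear functional of a standard Gaussian vector is Gaussian. -/
theorem hasLaw_inner (hg : ∀ i, HasLaw (g i) (gaussianReal 0 1) P) (hind : iIndepFun g P)
    (u : EuclideanSpace ℝ (Fin k)) :
    HasLaw (fun z => inner ℝ u (WithLp.toLp 2 fun i : Fin k => g i z))
      (gaussianReal 0 (‖u‖ ^ 2).toNNReal) P := by
  have h1 : HasLaw (fun z (i : Fin k) => g i z) (Measure.pi fun _ => gaussianReal 0 1) P :=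
    iIndepFun.hasLaw_pi (X := fun i : Fin k => g i) (fun i => hg i)
      (hind.precomp Fin.val_injective)
  have h2 : HasLaw (fun z => (WithLp.toLp 2 fun i : Fin k => g i z : EuclideanSpace ℝ (Fin k)))
      (stdGaussian (EuclideanSpace ℝ (Fin k))) P :=
    HasLaw.fun_comp (Y := WithLp.toLp 2)
      ⟨by fun_prop, map_pi_eq_stdGaussian⟩ h1
  refine HasLaw.fun_comp (Y := fun x => inner ℝ u x) ⟨by fun_prop, ?_⟩ h2
  have h3 := IsGaussian.map_eq_gaussianReal (μ := stdGaussian (EuclideanSpace ℝ (Fin k)))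
    (innerSL ℝ u)
  rw [integral_strongDual_stdGaussian, variance_dual_stdGaussian, innerSL_apply_norm] at h3
  exact h3

theorem measure_inner_eq_zero (hg : ∀ i, HasLaw (g i) (gaussianReal 0 1) P)
    (hind : iIndepFun g P) {u : EuclideanSpace ℝ (Fin k)} (hu : u ≠ 0) :
    P {z | inner ℝ u (WithLp.toLp 2 fun i : Fin k => g i z) = 0} = 0 := by
  have hv : (‖u‖ ^ 2).toNNReal ≠ 0 := by
    have : 0 < ‖u‖ := norm_pos_iff.2 hu
    simp only [ne_eq, Real.toNNReal_eq_zero, not_le]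
    positivity
  rw [(hasLaw_inner hg hind u).measure_eq (p := fun x => x = 0) (measurableSet_singleton 0)]
  have := nullSingletonClass_gaussianReal (μ := 0) hv
  exact measure_singleton 0

theorem measure_abs_inner_le (hg : ∀ i, HasLaw (g i) (gaussianReal 0 1) P)
    (hind : iIndepFun g P) {u : EuclideanSpace ℝ (Fin k)} (hu : ‖u‖ = 1) (δ : ℝ) :
    P {z | |inner ℝ u (WithLp.toLp 2 fun i : Fin k => g i z)| ≤ δ} ≤
      ENNReal.ofReal (4 / 5 * δ) := by
  rw [(hasLaw_inner hg hind u).measure_eq (p := fun x => |x| ≤ δ)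
    (measurableSet_le (by fun_prop) (by fun_prop)), hu]
  simpa using gaussianReal_abs_le δ

/-- Markov's inequality for the squared norm of a standard Gaussian vector. -/
theorem measure_norm_sq_ge (hg : ∀ i, HasLaw (g i) (gaussianReal 0 1) P) (hk : 1 ≤ k) {δ : ℝ}
    (hδ : 0 < δ) :
    P {z | 5 * k / δ ≤ ‖(WithLp.toLp 2 fun i : Fin k => g i z : EuclideanSpace ℝ (Fin k))‖ ^ 2} ≤
      ENNReal.ofReal (1 / 5 * δ) := by
  have hm : ∀ i, AEMeasurable (g i) P := fun i => (hg i).aemeasurable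
  have hk' : (0 : ℝ) < k := by exact_mod_cast hk
  have hpos : 0 < 5 * k / δ := by positivity
  have hint : ∫⁻ z, ENNReal.ofReal (∑ i : Fin k, g i z ^ 2) ∂P = k := by
    have : ∀ z, ENNReal.ofReal (∑ i : Fin k, g i z ^ 2) =
        ∑ i : Fin k, ENNReal.ofReal (g i z ^ 2) := fun z =>
      ENNReal.ofReal_sum_of_nonneg fun i _ => sq_nonneg _
    simp_rw [this]
    rw [lintegral_finsetSum' _ fun i _ => by have := hm i; fun_prop]
    have h1 : ∀ i : Fin k, ∫⁻ z, ENNReal.ofReal (g i z ^ 2) ∂P = 1 := fun i => by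
      rw [← lintegral_sq_gaussianReal]
      exact (hg i).lintegral_comp (f := fun x => ENNReal.ofReal (x ^ 2)) (by fun_prop)
    simp [h1]
  have hmk := mul_meas_ge_le_lintegral₀ (μ := P)
    (f := fun z => ENNReal.ofReal (∑ i : Fin k, g i z ^ 2))
    (by have := fun i : Fin k => hm i; fun_prop) (ENNReal.ofReal (5 * k / δ))
  rw [hint] at hmk
  have hset : {z | 5 * k / δ ≤
      ‖(WithLp.toLp 2 fun i : Fin k => g i z : EuclideanSpace ℝ (Fin k))‖ ^ 2} =
      {z | ENNReal.ofReal (5 * k / δ) ≤ ENNReal.ofReal (∑ i : Fin k, g i z ^ 2)} := by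
    ext z
    simp only [Set.mem_ofPred_eq]
    rw [ENNReal.ofReal_le_ofReal_iff (Finset.sum_nonneg fun _ _ => sq_nonneg _),
      EuclideanSpace.real_norm_sq_eq]
  rw [hset]
  have hne : ENNReal.ofReal (5 * k / δ) ≠ 0 := by simpa using hpos
  rw [mul_comm, ← ENNReal.le_div_iff_mul_le (Or.inl hne) (Or.inl ENNReal.ofReal_ne_top)] at hmk
  refine hmk.trans (le_of_eq ?_)
  rw [← ENNReal.ofReal_natCast, ← ENNReal.ofReal_div_of_pos hpos]
  congr 1
  field_simp

/-- The random start of the inverse iteration is good with probability at least `1 - δ`. -/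
theorem le_measure_of_good_start [IsProbabilityMeasure P]
    (hg : ∀ i, HasLaw (g i) (gaussianReal 0 1) P)
    (hind : iIndepFun g P) (hk : 1 ≤ k) {u h : EuclideanSpace ℝ (Fin k)} (hu : ‖u‖ = 1)
    (hh : h ≠ 0) {δ : ℝ} (hδ : 0 < δ) {S : Set Ω}
    (hS : ∀ z, inner ℝ h (WithLp.toLp 2 fun i : Fin k => g i z) ≠ 0 →
      δ < |inner ℝ u (WithLp.toLp 2 fun i : Fin k => g i z)| →
      ‖(WithLp.toLp 2 fun i : Fin k => g i z : EuclideanSpace ℝ (Fin k))‖ ^ 2 < 5 * k / δ →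
      z ∈ S) :
    ENNReal.ofReal (1 - δ) ≤ P S := by
  have hcompl : P Sᶜ ≤ ENNReal.ofReal δ := by
    have hsub : Sᶜ ⊆ ({z | inner ℝ h (WithLp.toLp 2 fun i : Fin k => g i z) = 0} ∪
        {z | |inner ℝ u (WithLp.toLp 2 fun i : Fin k => g i z)| ≤ δ}) ∪
        {z | 5 * k / δ ≤
          ‖(WithLp.toLp 2 fun i : Fin k => g i z : EuclideanSpace ℝ (Fin k))‖ ^ 2} := by
      intro z hz
      by_contra hcon
      simp only [Set.mem_union, Set.mem_ofPred_eq, not_or, not_le] at hcon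
      exact hz (hS z hcon.1.1 hcon.1.2 hcon.2)
    calc P Sᶜ ≤ _ := measure_mono hsub
      _ ≤ _ := measure_union_le _ _
      _ ≤ (0 + ENNReal.ofReal (4 / 5 * δ)) + ENNReal.ofReal (1 / 5 * δ) := by
        gcongr
        · refine (measure_union_le _ _).trans ?_
          gcongr
          · exact (measure_inner_eq_zero hg hind hh).le
          · exact measure_abs_inner_le hg hind hu δ
        · exact measure_norm_sq_ge hg hk hδ
      _ = ENNReal.ofReal δ := by
        rw [zero_add, ← ENNReal.ofReal_add (by positivity) (by positivity)]
        congr 1; ring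
  have huniv : 1 ≤ P S + P Sᶜ := by
    rw [← measure_univ (μ := P), ← Set.union_compl_self S]
    exact measure_union_le _ _
  rw [ENNReal.ofReal_sub _ hδ.le, ENNReal.ofReal_one]
  exact tsub_le_iff_right.2 (huniv.trans (by gcongr))

end

/-! ### The substitutions and the inverse iteration loop -/

section

variable {n : ℕ}

/-- The result of `solveTranspose`: forward substitution for `T'ᵀ z = v`. -/
def forwardSub (s : State n) (v : ℕ → ℝ) : ℕ → ℕ → ℝ
  | 0 => fun _ => 0
  | i + 1 => Function.update (forwardSub s v i) (i + 1)
      ((v (i + 1) - s.e (i + 1) * forwardSub s v i i - s.f (i + 1) * forwardSub s v i (i - 1)) /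
        s.d (i + 1))

theorem det_solveTranspose (A : Matrix (Fin n) (Fin n) ℝ) (TA : ℕ) (s : State n) (v : ℕ → ℝ)
    (k : ℕ) : Prog.Det A TA (solveTranspose s v k) (forwardSub s v k) (5 * k) := by
  induction k with
  | zero => exact Prog.det_pure _
  | succ i ih =>
    refine Prog.Det.mono ?_ (c := 5 * i + (1 + (1 + (1 + (1 + (1 + 0)))))) (by omega)
    refine ih.bind ?_
    refine (Prog.det_mulP _ _).bind ?_
    refine (Prog.det_mulP _ _).bind ?_
    refine (Prog.det_subP _ _).bind ?_
    refine (Prog.det_subP _ _).bind ?_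
    refine (Prog.det_divP _ _).bind ?_
    exact Prog.det_pure _

theorem det_solveUpper (A : Matrix (Fin n) (Fin n) ℝ) (TA : ℕ) (s : State n) (z : ℕ → ℝ)
    (i : ℕ) (v : ℕ → ℝ) :
    Prog.Det A TA (solveUpper s z i v) (backSub s.d s.e s.f z i v) (5 * i) := by
  induction i generalizing v with
  | zero => exact Prog.det_pure _
  | succ i ih =>
    refine Prog.Det.mono ?_ (c := 1 + (1 + (1 + (1 + (1 + 5 * i))))) (by omega)
    refine (Prog.det_mulP _ _).bind ?_
    refine (Prog.det_mulP _ _).bind ?_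
    refine (Prog.det_subP _ _).bind ?_
    refine (Prog.det_subP _ _).bind ?_
    refine (Prog.det_divP _ _).bind ?_
    exact ih _

theorem forwardSub_of_gt (s : State n) (v : ℕ → ℝ) {i j : ℕ} (h : j = 0 ∨ i < j) :
    forwardSub s v i j = 0 := by
  induction i with
  | zero => rfl
  | succ i ih => rw [forwardSub, Function.update_of_ne (by omega), ih (by omega)]

theorem forwardSub_spec (s : State n) (v : ℕ → ℝ) {i j : ℕ}
    (hd : ∀ l, 1 ≤ l → l ≤ i → s.d l ≠ 0) (hj : j + 1 ≤ i) :
    s.d (j + 1) * forwardSub s v i (j + 1) + s.e (j + 1) * forwardSub s v i j +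
      s.f (j + 1) * forwardSub s v i (j - 1) = v (j + 1) := by
  induction i with
  | zero => omega
  | succ i ih =>
    rw [forwardSub, Function.update_of_ne (by omega : j ≠ i + 1),
      Function.update_of_ne (by omega : j - 1 ≠ i + 1)]
    rcases Nat.lt_or_ge j i with h | h
    · rw [Function.update_of_ne (by omega)]
      exact ih (fun l h1 h2 => hd l h1 (by omega)) h
    · obtain rfl : j = i := by omega
      rw [Function.update_self]
      have := hd (j + 1) (by omega) le_rfl
      field_simp
      ring

/-- Summation by parts: `zᵀ (T' u) = (T'ᵀ z)ᵀ u`, up to terms with the entries `k + 1` and `k + 2`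
of `u`. -/
theorem sum_mul_adjoint (s : State n) (z u : ℕ → ℝ) (hz : z 0 = 0) (k : ℕ) :
    ∑ j ∈ Finset.range k, z (j + 1) * s.mul u (j + 1) =
      ∑ j ∈ Finset.range k, u (j + 1) *
        (s.d (j + 1) * z (j + 1) + s.e (j + 1) * z j + s.f (j + 1) * z (j - 1)) +
      (z k * (s.e (k + 1) * u (k + 1) + s.f (k + 2) * u (k + 2)) +
        z (k - 1) * (s.f (k + 1) * u (k + 1))) := by
  induction k with
  | zero => simp [hz]
  | succ k ih =>
    rw [Finset.sum_range_succ, Finset.sum_range_succ, ih, State.mul, upperMul,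
      Nat.add_sub_cancel]
    ring

/-- The coordinates `1, …, k` of a sequence as a Euclidean vector. -/
def vec (k : ℕ) (z : ℕ → ℝ) : EuclideanSpace ℝ (Fin k) := WithLp.toLp 2 fun i => z (i + 1)

/-- The sequence with a given Euclidean vector at the indices `1, …, k`, and zero elsewhere. -/
def toSeq {k : ℕ} (x : EuclideanSpace ℝ (Fin k)) (j : ℕ) : ℝ :=
  if h : 1 ≤ j ∧ j ≤ k then x ⟨j - 1, by omega⟩ else 0

theorem toSeq_suppOn {k : ℕ} (x : EuclideanSpace ℝ (Fin k)) : SuppOn k (toSeq x) :=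
  fun j hj => dif_neg (by omega)

theorem vec_toSeq {k : ℕ} (x : EuclideanSpace ℝ (Fin k)) : vec k (toSeq x) = x := by
  ext i
  simp only [vec, toSeq]
  rw [dif_pos ⟨by omega, by omega⟩]
  rfl

theorem toSeq_vec {k : ℕ} {z : ℕ → ℝ} (hz : SuppOn k z) : toSeq (vec k z) = z := by
  funext j
  by_cases h : 1 ≤ j ∧ j ≤ k
  · rw [toSeq, dif_pos h]
    simp only [vec]
    rw [Nat.sub_add_cancel h.1]
  · rw [toSeq, dif_neg h, hz j (by omega)]

theorem vec_congr {k : ℕ} {z y : ℕ → ℝ} (h : ∀ j, 1 ≤ j → j ≤ k → z j = y j) :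
    vec k z = vec k y := by
  ext i
  exact h (i + 1) (by omega) (by omega)

theorem inner_vec (k : ℕ) (z y : ℕ → ℝ) :
    inner ℝ (vec k z) (vec k y) = ∑ j ∈ Finset.range k, z (j + 1) * y (j + 1) := by
  rw [Finset.sum_range]
  simp only [vec, PiLp.inner_apply, RCLike.inner_apply, conj_trivial]
  exact Finset.sum_congr rfl fun i _ => mul_comm _ _

theorem norm_vec_sq (k : ℕ) (z : ℕ → ℝ) : ‖vec k z‖ ^ 2 = sqSum k z := by
  rw [← real_inner_self_eq_norm_sq, inner_vec, sqSum]
  exact Finset.sum_congr rfl fun i _ => (pow_two _).symm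

theorem vec_smul (k : ℕ) (c : ℝ) (z : ℕ → ℝ) : vec k (fun j => c * z j) = c • vec k z := rfl

/-- The matrix `T'` as a linear map. -/
def State.toMap (k : ℕ) (s : State n) :
    EuclideanSpace ℝ (Fin k) →ₗ[ℝ] EuclideanSpace ℝ (Fin k) where
  toFun x := vec k (s.mul (toSeq x))
  map_add' x y := by
    have : toSeq (x + y) = fun j => toSeq x j + toSeq y j := by
      funext j
      simp only [toSeq]
      split_ifs <;> simp
    ext i
    simp only [vec, State.mul, this, upperMul_add, PiLp.add_apply]
  map_smul' c x := by
    have : toSeq (c • x) = fun j => c * toSeq x j := by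
      funext j
      simp only [toSeq]
      split_ifs <;> simp
    ext i
    simp only [vec, State.mul, this, upperMul_smul, PiLp.smul_apply, RingHom.id_apply, smul_eq_mul]

theorem State.toMap_vec {k : ℕ} (s : State n) {z : ℕ → ℝ} (hz : SuppOn k z) :
    s.toMap k (vec k z) = vec k (s.mul z) := by
  change vec k (s.mul (toSeq (vec k z))) = _
  rw [toSeq_vec hz]

theorem State.toMap_injective {k : ℕ} {s : State n} (hd : ∀ j, 1 ≤ j → j ≤ k → s.d j ≠ 0) :
    Function.Injective (s.toMap k) := by
  rw [LinearMap.injective_iff_surjective]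
  intro y
  have hs : SuppOn k (backSub s.d s.e s.f (toSeq y) k fun _ => 0) := fun j hj =>
    backSub_apply _ _ _ _ _ _ hj
  refine ⟨vec k (backSub s.d s.e s.f (toSeq y) k fun _ => 0), ?_⟩
  rw [s.toMap_vec hs]
  conv_rhs => rw [← vec_toSeq y]
  exact vec_congr fun j h1 h2 => upperMul_backSub _ _ hd h1 h2

/-- The solution of `T'ᵀ T' y = v` that the two substitutions compute. -/
def solveGram (s : State n) (k : ℕ) (v : ℕ → ℝ) : ℕ → ℝ :=
  backSub s.d s.e s.f (forwardSub s v k) k fun _ => 0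

theorem gram_solveGram {k : ℕ} {s : State n} (hd : ∀ j, 1 ≤ j → j ≤ k → s.d j ≠ 0)
    (v : ℕ → ℝ) : gram (s.toMap k) (vec k (solveGram s k v)) = vec k v := by
  refine ext_inner_left ℝ fun x => ?_
  have hs : SuppOn k (solveGram s k v) := fun j hj => backSub_apply _ _ _ _ _ _ hj
  have h1 : vec k (s.mul (solveGram s k v)) = vec k (forwardSub s v k) :=
    vec_congr fun j h1 h2 => upperMul_backSub _ _ hd h1 h2
  rw [inner_gram, s.toMap_vec hs, h1, real_inner_comm]
  conv_rhs => rw [← vec_toSeq x]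
  change inner ℝ (vec k (forwardSub s v k)) (vec k (s.mul (toSeq x))) = _
  rw [inner_vec, inner_vec, sum_mul_adjoint s _ _ (forwardSub_of_gt s v (Or.inl rfl)),
    toSeq_suppOn x (k + 1) (Or.inr (by omega)), toSeq_suppOn x (k + 2) (Or.inr (by omega))]
  simp only [mul_zero, add_zero]
  refine Finset.sum_congr rfl fun j hj => ?_
  rw [Finset.mem_range] at hj
  rw [forwardSub_spec s v hd (by omega)]

/-- The result of one step of normalized inverse iteration. -/
def invNext (s : State n) (k : ℕ) (v : ℕ → ℝ) : ℕ → ℝ :=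
  Prog.trunc k fun i => solveGram s k v i / euclNorm fun i : Fin k => solveGram s k v (i + 1)

theorem trunc_suppOn (k : ℕ) (g : ℕ → ℝ) : SuppOn k (Prog.trunc k g) :=
  fun _ hj => if_neg (by omega)

theorem vec_trunc (k : ℕ) (g : ℕ → ℝ) : vec k (Prog.trunc k g) = vec k g :=
  vec_congr fun _ h1 h2 => if_pos ⟨h1, h2⟩

theorem det_inverseStep (A : Matrix (Fin n) (Fin n) ℝ) (TA : ℕ) (s : State n) (k : ℕ)
    (v : ℕ → ℝ) : Prog.Det A TA (inverseStep s k v) (invNext s k v) (13 * k + 1) := by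
  refine Prog.Det.mono ?_ (c := 5 * k + (5 * k + (2 * k + 1 + k * 1))) (by omega)
  refine (det_solveTranspose A TA s v k).bind ?_
  refine (det_solveUpper A TA s _ k _).bind ?_
  refine (Prog.det_normP _).bind ?_
  exact Prog.det_arrayP (fun i => Prog.det_divP _ _) k

/-- The loop makes all the passes that its first argument allows, because that argument is the
rounded threshold. -/
theorem det_inverseLoop (A : Matrix (Fin n) (Fin n) ℝ) (TA : ℕ) (s : State n) (k : ℕ) {thr : ℝ}
    (m : ℕ) (l : ℝ) (v : ℕ → ℝ) (h : ∀ j : ℕ, j < m → l + j < thr) :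
    Prog.Det A TA (inverseLoop s k thr m l v) ((invNext s k)^[m] v) (m * (13 * k + 3)) := by
  induction m generalizing l v with
  | zero => exact (Prog.det_pure _).mono (by omega)
  | succ m ih =>
    refine Prog.Det.mono ?_ (c := 1 + (13 * k + 1 + (1 + m * (13 * k + 3))))
      (by rw [add_mul]; omega)
    refine (Prog.det_lessP _ _).bind ?_
    have h0 : l < thr := by simpa using h 0 (by omega)
    rw [if_pos (decide_eq_true h0), Function.iterate_succ_apply]
    refine (det_inverseStep A TA s k v).bind ?_
    refine (Prog.det_addP _ _).bind ?_
    refine ih _ _ fun j hj => ?_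
    have := h (j + 1) (by omega)
    push_cast at this
    linarith

theorem invNext_iterate_suppOn {s : State n} {k : ℕ} {v : ℕ → ℝ} (hv : SuppOn k v) (m : ℕ) :
    SuppOn k ((invNext s k)^[m] v) := by
  cases m with
  | zero => exact hv
  | succ m =>
    rw [Function.iterate_succ_apply']
    exact trunc_suppOn _ _

/-- Up to a nonzero factor, `m` steps of normalized inverse iteration apply `(T'ᵀ T')⁻ᵐ`. -/
theorem gram_pow_invNext {s : State n} {k : ℕ} (hd : ∀ j, 1 ≤ j → j ≤ k → s.d j ≠ 0)
    {v : ℕ → ℝ} (hv : vec k v ≠ 0) (m : ℕ) :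
    ∃ c : ℝ, c ≠ 0 ∧ (gram (s.toMap k) ^ m) (vec k ((invNext s k)^[m] v)) = c • vec k v := by
  induction m with
  | zero => exact ⟨1, one_ne_zero, by simp⟩
  | succ m ih =>
    obtain ⟨c, hc, h⟩ := ih
    set w := (invNext s k)^[m] v
    have hw : vec k w ≠ 0 := fun h0 => by
      rw [h0, map_zero] at h
      exact smul_ne_zero hc hv h.symm
    set r := euclNorm fun i : Fin k => solveGram s k w (i + 1) with hr
    have hr0 : r ≠ 0 := by
      refine (euclNorm_pos fun h0 => hw ?_).ne'
      have h1 : vec k (solveGram s k w) = 0 := by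
        ext i
        exact congrFun h0 i
      rw [← gram_solveGram hd w, h1, map_zero]
    refine ⟨r⁻¹ * c, mul_ne_zero (inv_ne_zero hr0) hc, ?_⟩
    have e : vec k (invNext s k w) = r⁻¹ • vec k (solveGram s k w) := by
      rw [invNext, vec_trunc, ← vec_smul]
      exact vec_congr fun j _ _ => div_eq_inv_mul _ _
    rw [Function.iterate_succ_apply', e, pow_succ, Module.End.mul_apply, map_smul,
      gram_solveGram hd, map_smul, h, smul_smul]

/-- The number of passes of the inverse iteration loop. -/
def passes (δ : ℝ) (k : ℕ) : ℕ := ⌈2.23 * Real.log (k / (δ * δ))⌉₊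

theorem runs_singularVector (A : Matrix (Fin n) (Fin n) ℝ) (TA : ℕ) (δ : ℝ) (k : ℕ)
    (s : State n) (ω : ℕ → ℝ) (hd : 0 < s.d k) :
    Prog.Runs A TA (singularVector δ k s) ω
      ((invNext s k)^[passes δ k] (Prog.trunc k fun i => ω (i - 1)))
      (5 + k + passes δ k * (13 * k + 3)) fun i => ω (i + k) := by
  refine Prog.Runs.mono ?_ (c := 1 + (k + (1 + (1 + (1 + (1 + passes δ k * (13 * k + 3)))))))
    (by omega)
  refine (Prog.det_lessP _ _ ω).bind ?_
  rw [if_pos (decide_eq_true hd)]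
  refine (Prog.runs_arrayP_gaussP ω k).bind ?_
  refine (Prog.det_mulP _ _ _).bind ?_
  refine (Prog.det_divP _ _ _).bind ?_
  refine (Prog.det_lnP _ _).bind ?_
  refine (Prog.det_mulP _ _ _).bind ?_
  refine det_inverseLoop A TA s k _ _ _ (fun j hj => ?_) _
  rw [zero_add]
  exact Nat.lt_ceil.1 hj

theorem det_singularVector (A : Matrix (Fin n) (Fin n) ℝ) (TA : ℕ) (δ : ℝ) (k : ℕ)
    (s : State n) (hd : s.d k = 0) :
    Prog.Det A TA (singularVector δ k s) (nullVec s.d s.e s.f k) (5 + k + 5 * k) := by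
  refine Prog.Det.mono ?_ (c := 1 + 5 * (k - 1)) (by omega)
  refine (Prog.det_lessP _ _).bind ?_
  rw [if_neg (by simp [hd])]
  exact det_solveUpper A TA s _ _ _

/-- The run of `minberr`, given the run of the main loop and the vector `v` of the last phase. -/
theorem runs_minberr {A : Matrix (Fin n) (Fin n) ℝ} {TA : ℕ} {b : Fin n → ℝ} {kmax : ℕ}
    {ε δ : ℝ} {ω ω' : ℕ → ℝ} {k : ℕ} {s : State n} {v : ℕ → ℝ} {c1 c2 : ℕ}
    (h1 : Prog.Det A TA (mainLoop ε kmax 0 (initState fun i => b i / euclNorm b)) (k, s) c1)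
    (h2 : Prog.Runs A TA (singularVector δ k s) ω v c2 ω') :
    Prog.Runs A TA (minberr b kmax ε δ) ω
      { steps := k, x := comb k s fun j => v j / (s.firstRow v / euclNorm b) }
      (3 * n + 1 + c1 + c2 + 4 + n * (2 * k + 1)) ω' := by
  refine Prog.Runs.mono ?_ (c := (2 * n + 1) + (n * 1 + (c1 + (c2 + (1 + (1 + (1 + (1 +
    (n * (k * (1 + 1) + 1) + 0))))))))) (by
      have : k * (1 + 1) + 1 = 2 * k + 1 := by omega
      rw [this]; omega)
  refine (Prog.det_normP b ω).bind ?_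
  refine (Prog.det_vecP (fun i => Prog.det_divP _ _) ω).bind ?_
  refine (h1 ω).bind ?_
  refine h2.bind ?_
  refine (Prog.det_mulP _ _ ω').bind ?_
  refine (Prog.det_mulP _ _ ω').bind ?_
  refine (Prog.det_addP _ _ ω').bind ?_
  refine (Prog.det_divP _ _ ω').bind ?_
  have e : (comb k s fun j => v j / (s.firstRow v / euclNorm b)) = fun i =>
      (∑ j : Fin k, v (j + 1) * s.q (j + 1) i) / ((s.α 1 * v 1 + s.β 2 * v 2) / euclNorm b) := by
    funext i
    rw [comb, Finset.sum_apply, Finset.sum_range, Finset.sum_div]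
    refine Finset.sum_congr rfl fun j _ => ?_
    rw [Pi.smul_apply, smul_eq_mul, State.firstRow]
    ring
  rw [e]
  refine Prog.Runs.bind (Prog.det_vecP (c := k * (1 + 1) + 1) (fun i => ?_) ω')
    (Prog.det_pure _ _)
  exact (Prog.det_sumP fun j => Prog.det_mulP _ _).bind (Prog.det_divP _ _)

end

/-! ### The minimal backward error over the Krylov subspace -/

section

variable {n : ℕ} {A : Matrix (Fin n) (Fin n) ℝ} {b : Fin n → ℝ} {k : ℕ} {s : State n}

theorem IsLanczos.euclNorm_comb (h : IsLanczos A b k s) (z : ℕ → ℝ) :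
    euclNorm (comb k s z) = ‖vec k z‖ := by
  rw [euclNorm, h.comb_dotProduct_self, ← norm_vec_sq, Real.sqrt_sq (norm_nonneg _)]

theorem IsLanczos.le_berr_comb (h : IsLanczos A b k s) (hB : IsBand k s) (hk : 1 ≤ k)
    (hA : 0 < specNorm A) {z : ℕ → ℝ} (hz : SuppOn k z) (hne : vec k z ≠ 0) :
    ENNReal.ofReal (‖vec k (s.mul z)‖ / ‖vec k z‖ / specNorm A) ≤ berr A b (comb k s z) := by
  have hp : 0 < ‖vec k z‖ := norm_pos_iff.2 hne
  have hx : comb k s z ≠ 0 := fun h0 => by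
    rw [← h.euclNorm_comb, h0] at hp
    simp [euclNorm] at hp
  rw [berr_eq hA b hx, h.euclNorm_comb]
  have hr := h.residual_sq hB hk hz
  have : ‖vec k (s.mul z)‖ ≤ euclNorm (b - A.mulVec (comb k s z)) := by
    refine le_of_sq_le_sq ?_ (euclNorm_nonneg _)
    rw [hr, norm_vec_sq]
    linarith [sq_nonneg (euclNorm b - s.firstRow z)]
  gcongr

/-- With the scaling that annihilates the part of the residual along `b`, the backward error is the
quotient `‖T' z‖ / ‖z‖`, up to the factor `‖A‖`. -/
theorem IsLanczos.berr_scaled (h : IsLanczos A b k s) (hB : IsBand k s) (hk : 1 ≤ k)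
    (hA : 0 < specNorm A) (hb : b ≠ 0) {z : ℕ → ℝ} (hz : SuppOn k z)
    (hrow : s.firstRow z ≠ 0) (hne : vec k z ≠ 0) :
    berr A b (comb k s fun j => z j / (s.firstRow z / euclNorm b)) =
      ENNReal.ofReal (‖vec k (s.mul z)‖ / ‖vec k z‖ / specNorm A) := by
  have hbp := euclNorm_pos hb
  obtain ⟨c, hc⟩ : ∃ c, c = euclNorm b / s.firstRow z := ⟨_, rfl⟩
  have hc0 : c ≠ 0 := by rw [hc]; exact div_ne_zero hbp.ne' hrow
  have e : (fun j => z j / (s.firstRow z / euclNorm b)) = fun j => c * z j := by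
    funext j
    rw [hc]
    field_simp
  have hy : SuppOn k fun j => c * z j := fun j hj => by simp only [hz j hj, mul_zero]
  have hmul : s.mul (fun j => c * z j) = fun j => c * s.mul z j := by
    funext j; exact upperMul_smul _ _ _ _ _ _
  have hfr : s.firstRow (fun j => c * z j) = euclNorm b := by
    have : s.firstRow (fun j => c * z j) = c * s.firstRow z := by simp only [State.firstRow]; ring
    rw [this, hc]
    field_simp
  have hcp : 0 < |c| := abs_pos.2 hc0
  have hp : 0 < ‖vec k z‖ := norm_pos_iff.2 hne
  have hnorm : euclNorm (comb k s fun j => c * z j) = |c| * ‖vec k z‖ := by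
    rw [h.euclNorm_comb, vec_smul, norm_smul, Real.norm_eq_abs]
  have hx : (comb k s fun j => c * z j) ≠ 0 := fun h0 => by
    rw [h0] at hnorm
    have : 0 < |c| * ‖vec k z‖ := by positivity
    rw [← hnorm] at this
    simp [euclNorm] at this
  have hr := h.residual_sq hB hk hy
  rw [hfr, sub_self, hmul, ← norm_vec_sq, vec_smul, norm_smul, Real.norm_eq_abs,
    zero_pow two_ne_zero, zero_add] at hr
  have hres := (sq_eq_sq₀ (euclNorm_nonneg _) (by positivity)).1 hr
  rw [e, berr_eq hA b hx, hres, hnorm, mul_div_mul_left _ _ hcp.ne']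

theorem IsLanczos.exists_suppOn_of_mem_krylov (h : IsLanczos A b k s) (hb : b ≠ 0)
    {x : Fin n → ℝ} (hx : x ∈ krylov A b k) : ∃ z, SuppOn k z ∧ x = comb k s z := by
  obtain ⟨z, rfl⟩ := (h.mem_krylov_iff hb x).1 hx
  refine ⟨Prog.trunc k z, trunc_suppOn k z, ?_⟩
  refine Finset.sum_congr rfl fun j hj => ?_
  rw [Finset.mem_range] at hj
  rw [Prog.trunc, if_pos (by omega)]

/-- If `β (k + 1) ≠ 0` then the minimum is the smallest singular value of `T'`, divided
by `‖A‖`. -/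
theorem IsLanczos.isLeast_berr (hpd : A.PosDef) (h : IsLanczos A b k s) (hB : IsBand k s)
    (hk : 1 ≤ k) (hb : b ≠ 0) (hβ : s.β (k + 1) ≠ 0) {σ : ℝ}
    {u : EuclideanSpace ℝ (Fin k)} (hσ : 0 < σ) (hu : ‖u‖ = 1) (hTu : ‖s.toMap k u‖ = σ)
    (hmin : ∀ v, σ * ‖v‖ ≤ ‖s.toMap k v‖) :
    IsLeast (berr A b '' (krylov A b k : Set (Fin n → ℝ))) (ENNReal.ofReal (σ / specNorm A)) ∧
      ∃ z, SuppOn k z ∧ s.firstRow z ≠ 0 := by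
  have hA := specNorm_pos hpd hb
  have hu2 : sqSum k (toSeq u) = 1 := by rw [← norm_vec_sq, vec_toSeq, hu, one_pow]
  have hu3 : sqSum k (s.mul (toSeq u)) = σ ^ 2 := by
    rw [← norm_vec_sq, ← s.toMap_vec (toSeq_suppOn u), vec_toSeq, hTu]
  obtain ⟨z, hz, h1, h2, h3⟩ :=
    h.exists_firstRow_ne_zero hpd hB hβ (toSeq_suppOn u) (by rw [hu2]; exact one_pos)
  rw [hu3, ← norm_vec_sq] at h1
  rw [hu2, ← norm_vec_sq] at h2
  have hz1 : 1 ≤ ‖vec k z‖ := by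
    nlinarith [norm_nonneg (vec k z)]
  have hz0 : vec k z ≠ 0 := norm_pos_iff.1 (by linarith)
  have hmulz : ‖vec k (s.mul z)‖ = σ := (sq_eq_sq₀ (norm_nonneg _) hσ.le).1 h1
  have hlow : ∀ x ∈ krylov A b k, ENNReal.ofReal (σ / specNorm A) ≤ berr A b x := by
    intro x hx
    obtain ⟨y, hy, rfl⟩ := h.exists_suppOn_of_mem_krylov hb hx
    by_cases hy0 : vec k y = 0
    · have : comb k s y = 0 := by
        by_contra hne
        have := euclNorm_pos hne
        rw [h.euclNorm_comb, hy0, norm_zero] at this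
        exact lt_irrefl _ this
      rw [this, berr_zero A hb]
      exact le_top
    · refine le_trans (ENNReal.ofReal_le_ofReal ?_) (h.le_berr_comb hB hk hA hy hy0)
      gcongr
      rw [le_div_iff₀ (norm_pos_iff.2 hy0), ← s.toMap_vec hy]
      exact hmin _
  refine ⟨⟨?_, ?_⟩, z, hz, h3⟩
  · have hmem : (comb k s fun j => z j / (s.firstRow z / euclNorm b)) ∈ krylov A b k :=
      (h.mem_krylov_iff hb _).2 ⟨_, rfl⟩
    refine ⟨_, hmem, le_antisymm ?_ (hlow _ hmem)⟩
    rw [h.berr_scaled hB hk hA hb hz h3 hz0, hmulz]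
    refine ENNReal.ofReal_le_ofReal ?_
    gcongr
    exact div_le_self hσ.le hz1
  · rintro _ ⟨x, hx, rfl⟩
    exact hlow x hx

/-- If `β (k + 1) = 0` then the null vector of `T'` gives an exact solution. -/
theorem IsLanczos.berr_nullVec (hpd : A.PosDef) (h : IsLanczos A b k s) (hB : IsBand k s)
    (hk : 1 ≤ k) (hb : b ≠ 0) (hβ : s.β (k + 1) = 0) :
    berr A b (comb k s fun j => nullVec s.d s.e s.f k j /
      (s.firstRow (nullVec s.d s.e s.f k) / euclNorm b)) = 0 := by
  set z := nullVec s.d s.e s.f k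
  have hz : SuppOn k z := nullVec_suppOn _ _ _ hk
  have hl : z k = 1 := nullVec_last _ _ _ hk
  have hm : ∀ j, 1 ≤ j → j ≤ k → s.mul z j = 0 := by
    intro j h1 h2
    rcases Nat.lt_or_ge j k with h3 | h3
    · refine upperMul_nullVec (fun l h1 h2 => ?_) h1 h3
      rw [hB.d_eq l h1 h2.le]
      exact (h.pos _ (by omega) (by omega)).ne'
    · obtain rfl : j = k := by omega
      rw [hB.mul_eq hz h1 h2, hβ, hz (j + 1) (Or.inr (by omega)), hz (j + 2) (Or.inr (by omega))]
      ring
  -- the sign pattern needs `(-1) ^ k` as last entry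
  have hrow : s.firstRow z ≠ 0 := by
    have hsq : (-1 : ℝ) ^ k * (-1) ^ k = 1 := by rw [← mul_pow]; norm_num
    have := h.firstRow_ne_zero hpd hB (z := fun j => (-1) ^ k * z j)
      (fun j hj => by simp only [hz j hj, mul_zero])
      (by simp only [hl, mul_one, hsq, zero_le_one])
      (fun j h1 h2 => by
        rw [State.mul, upperMul_smul]
        have := hm j h1 h2.le
        rw [State.mul] at this
        rw [this, mul_zero, mul_zero]) hk le_rfl (by simp [hl])
    intro h0
    refine this ?_
    have e : s.firstRow (fun j => (-1) ^ k * z j) = (-1) ^ k * s.firstRow z := by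
      simp only [State.firstRow]; ring
    rw [e, h0, mul_zero]
  have hne : vec k z ≠ 0 := by
    refine norm_pos_iff.1 ?_
    have := sqSum_pos hk le_rfl (z := z) (by rw [hl]; exact one_ne_zero)
    rw [← norm_vec_sq] at this
    exact lt_of_le_of_ne (norm_nonneg _) fun h0 => by rw [← h0] at this; norm_num at this
  have h0 : vec k (s.mul z) = 0 := by
    ext i
    exact hm (i + 1) (by omega) (by omega)
  rw [h.berr_scaled hB hk (specNorm_pos hpd hb) hb hz hrow hne, h0]
  simp

/-! ### Near-minimality of the output -/

/-- With probability at least `1 - δ` over the start, inverse iteration yields a vector whose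
backward error is at most `3 / 2` of the minimum `σ / ‖A‖`. -/
theorem IsLanczos.le_measure_inverse_iteration (hpd : A.PosDef) (h : IsLanczos A b k s)
    (hB : IsBand k s) (hk : 1 ≤ k) (hb : b ≠ 0) (hβ : s.β (k + 1) ≠ 0) {δ : ℝ} (hδ0 : 0 < δ)
    (hδ1 : δ < 1) :
    ∃ σ, 0 < σ ∧ (∀ z, SuppOn k z → σ * ‖vec k z‖ ≤ ‖vec k (s.mul z)‖) ∧
      IsLeast (berr A b '' (krylov A b k : Set (Fin n → ℝ)))
        (ENNReal.ofReal (σ / specNorm A)) ∧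
      ∀ (Ω : Type*) [MeasurableSpace Ω] (P : Measure Ω) [IsProbabilityMeasure P]
        (g : ℕ → Ω → ℝ), (∀ i, HasLaw (g i) (gaussianReal 0 1) P) → iIndepFun g P →
        ENNReal.ofReal (1 - δ) ≤ P {z | ∀ v,
          v = (invNext s k)^[passes δ k] (Prog.trunc k fun i => g (i - 1) z) →
          berr A b (comb k s fun j => v j / (s.firstRow v / euclNorm b)) ≤
            (1 + 1 / 2) * ENNReal.ofReal (σ / specNorm A)} := by
  have hA := specNorm_pos hpd hb
  have hd : ∀ j, 1 ≤ j → j ≤ k → s.d j ≠ 0 := fun j h1 h2 => by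
    rw [hB.d_eq j h1 h2]
    rcases Nat.lt_or_ge j k with h3 | h3
    · exact (h.pos _ (by omega) (by omega)).ne'
    · obtain rfl : j = k := by omega
      exact hβ
  have hinj := State.toMap_injective hd
  have : Nonempty (Fin k) := ⟨⟨0, hk⟩⟩
  obtain ⟨σ, u, hσ, hu, hTu, hmin, hit⟩ := exists_smallest_singular (s.toMap k) hinj
  obtain ⟨hleast, y, hy, hyrow⟩ := h.isLeast_berr hpd hB hk hb hβ hσ hu hTu hmin
  refine ⟨σ, hσ, fun z hz => by rw [← s.toMap_vec hz]; exact hmin _, hleast, ?_⟩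
  intro Ω _ P _ g hg hind
  set N := passes δ k with hN
  have hlogpos : 0 < 2.23 * Real.log (k / (δ * δ)) := by
    refine mul_pos (by norm_num) (Real.log_pos ?_)
    have : (1 : ℝ) ≤ k := by exact_mod_cast hk
    rw [lt_div_iff₀ (by positivity)]
    nlinarith
  have hN1 : 1 ≤ N := Nat.ceil_pos.2 hlogpos
  have hdecay := decay_le hk hδ0 hδ1 hN1 (Nat.le_ceil _)
  -- the first row of `T` as a vector, and its image under `(T'ᵀ T')⁻ᴺ`
  let t : EuclideanSpace ℝ (Fin k) :=
    vec k fun j => if j = 1 then s.α 1 else if j = 2 then s.β 2 else 0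
  have ht : ∀ z, SuppOn k z → s.firstRow z = inner ℝ t (vec k z) := by
    intro z hz
    rw [inner_vec]
    obtain ⟨m, rfl⟩ : ∃ m, k = m + 1 := ⟨k - 1, by omega⟩
    rw [Finset.sum_range_succ']
    rcases m with _ | m
    · simp [State.firstRow, hz 2 (Or.inr (by omega))]
    · rw [Finset.sum_range_succ', Finset.sum_eq_zero (fun j _ => by
        rw [if_neg (by omega), if_neg (by omega), zero_mul])]
      simp only [State.firstRow, zero_add, if_true, Nat.reduceAdd, OfNat.ofNat_ne_one, if_false]
      ring
  have ht0 : t ≠ 0 := fun h0 => hyrow (by rw [ht y hy, h0, inner_zero_left])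
  have hpinj : Function.Injective (gram (s.toMap k) ^ N) := by
    rw [Module.End.coe_pow]
    exact (gram_injective hinj).iterate N
  obtain ⟨w, hw⟩ := LinearMap.injective_iff_surjective.1 hpinj t
  have hw0 : w ≠ 0 := fun h0 => ht0 (by rw [← hw, h0, map_zero])
  refine le_measure_of_good_start hg hind hk hu hw0 hδ0 fun z h1 h2 h3 => ?_
  rintro v hv
  have hstart : vec k (Prog.trunc k fun i => g (i - 1) z) =
      WithLp.toLp 2 fun i : Fin k => g i z := vec_trunc _ _
  rw [← hstart] at h1 h2 h3
  set v0 := Prog.trunc k fun i => g (i - 1) z with hv0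
  have hv0ne : vec k v0 ≠ 0 := fun h0 => h1 (by rw [h0, inner_zero_right])
  obtain ⟨c, hc, hcv⟩ := gram_pow_invNext hd hv0ne N
  rw [← hv] at hcv
  have hvs : SuppOn k v := by rw [hv]; exact invNext_iterate_suppOn (trunc_suppOn _ _) N
  have hvne : vec k v ≠ 0 := fun h0 => by
    rw [h0, map_zero] at hcv
    exact smul_ne_zero hc hv0ne hcv.symm
  have hrow : s.firstRow v ≠ 0 := by
    rw [ht v hvs, ← hw, ← gram_pow_symm, hcv, inner_smul_right]
    exact mul_ne_zero hc h1
  have hbound : ‖s.toMap k (vec k v)‖ ≤ 3 / 2 * (σ * ‖vec k v‖) := by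
    refine hit N hN1 _ ?_
    rw [hcv, norm_smul, inner_smul_right, Real.norm_eq_abs, mul_pow, mul_pow, sq_abs]
    have hdn : 0 ≤ decay N := by unfold decay; positivity
    have h4 : decay N * ‖vec k v0‖ ^ 2 ≤ 5 / 4 * inner ℝ u (vec k v0) ^ 2 := by
      calc decay N * ‖vec k v0‖ ^ 2 ≤ decay N * (5 * k / δ) := by gcongr
        _ ≤ 5 / 4 * δ ^ 2 := hdecay
        _ ≤ 5 / 4 * |inner ℝ u (vec k v0)| ^ 2 := by gcongr
        _ = _ := by rw [sq_abs]
    nlinarith [mul_le_mul_of_nonneg_left h4 (sq_nonneg c)]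
  rw [h.berr_scaled hB hk hA hb hvs hrow hvne, ← s.toMap_vec hvs]
  have h32 : (1 + 1 / 2 : ℝ≥0∞) = ENNReal.ofReal (3 / 2) := by
    rw [show (3 / 2 : ℝ) = 1 + 1 / 2 by norm_num, ENNReal.ofReal_add (by norm_num) (by norm_num),
      ENNReal.ofReal_one, ENNReal.ofReal_div_of_pos (by norm_num)]
    simp
  rw [h32, ← ENNReal.ofReal_mul (by norm_num)]
  refine ENNReal.ofReal_le_ofReal ?_
  rw [← mul_div_assoc]
  gcongr
  rw [div_le_iff₀ (norm_pos_iff.2 hvne)]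
  linarith

end

/-! ### The number of operations -/

/-- The term `log k` of the number of passes is absorbed by `k ≤ n`. -/
theorem passes_le {n k : ℕ} {δ : ℝ} (hk : 1 ≤ k) (hkn : k ≤ n) (hδ0 : 0 < δ) (hδ1 : δ < 1) :
    (passes δ k : ℝ) ≤ 4 * n + 5 * Real.log (1 / δ) := by
  have hk' : (1 : ℝ) ≤ k := by exact_mod_cast hk
  have hkn' : (k : ℝ) ≤ n := by exact_mod_cast hkn
  have hL : 0 < Real.log (1 / δ) := Real.log_pos (by rwa [lt_div_iff₀ hδ0, one_mul])
  have e : Real.log (k / (δ * δ)) = Real.log k + 2 * Real.log (1 / δ) := by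
    rw [Real.log_div (by positivity) (by positivity), Real.log_mul hδ0.ne' hδ0.ne',
      Real.log_div one_ne_zero hδ0.ne', Real.log_one]
    ring
  have hlogk : Real.log k ≤ k - 1 := Real.log_le_sub_one_of_pos (by positivity)
  have hlog0 : 0 ≤ Real.log k := Real.log_nonneg hk'
  have := (Nat.ceil_lt_add_one (a := 2.23 * Real.log (k / (δ * δ)))
    (by rw [e]; positivity)).le
  rw [e] at this
  rw [passes, e]
  linarith

theorem cost_le {n k TA c : ℕ} {δ : ℝ} (hk : 1 ≤ k) (hkn : k ≤ n) (hδ0 : 0 < δ)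
    (hδ1 : δ < 1) (hc : c ≤ 5 + k + passes δ k * (13 * k + 3) ∨ c ≤ 5 + k + 5 * k) :
    ((3 * n + 1 + k * (TA + 9 * n + 22) + c + 4 + n * (2 * k + 1) : ℕ) : ℝ) ≤
      200 * (k * (TA + n + Real.log (1 / δ))) := by
  have hk' : (1 : ℝ) ≤ k := by exact_mod_cast hk
  have hkn' : (k : ℝ) ≤ n := by exact_mod_cast hkn
  have hL : 0 < Real.log (1 / δ) := Real.log_pos (by rwa [lt_div_iff₀ hδ0, one_mul])
  have hN := passes_le hk hkn hδ0 hδ1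
  have hc' : (c : ℝ) ≤ 5 + k + passes δ k * (13 * k + 3) + 5 * k := by
    rcases hc with hc | hc
    · have : (c : ℝ) ≤ 5 + k + passes δ k * (13 * k + 3) := by exact_mod_cast hc
      linarith
    · have : (c : ℝ) ≤ 5 + k + 5 * k := by exact_mod_cast hc
      have : (0 : ℝ) ≤ passes δ k * (13 * k + 3) := by positivity
      linarith
  have hNk : (passes δ k : ℝ) * (13 * k + 3) ≤
      (4 * n + 5 * Real.log (1 / δ)) * (16 * k) := by
    have : (13 * k + 3 : ℝ) ≤ 16 * k := by linarith
    gcongr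
  have hkL : 0 ≤ k * Real.log (1 / δ) := by positivity
  have hkT : (0 : ℝ) ≤ k * TA := by positivity
  have h1 : (n : ℝ) ≤ k * n := by nlinarith
  have h2 : (k : ℝ) ≤ k * n := by nlinarith
  push_cast
  nlinarith

end Minberr

end

theorem theorem4p4 :
    ∃ C : ℝ, ∀ (n : ℕ) (A : Matrix (Fin n) (Fin n) ℝ) (b : Fin n → ℝ),
      A.PosDef → b ≠ 0 →
      ∀ (kmax : ℕ) (ε δ : ℝ), 1 ≤ kmax → 0 ≤ ε → 0 < δ → δ < 1 →
      ∃ k : ℕ, 1 ≤ k ∧ k ≤ kmax ∧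
        -- the run makes fewer than `kmax` steps only if the tolerance is met
        (k = kmax ∨ ∃ x ∈ Minberr.krylov A b k,
          ENNReal.ofReal (Minberr.specNorm A) * Minberr.berr A b x ≤ ENNReal.ofReal ε) ∧
        -- whatever the random draws: `k` steps and the bound on the number of operations
        (∀ (TA : ℕ) (ω : ℕ → ℝ),
          ((Minberr.minberr b kmax ε δ).exec A TA ω).1.steps = k ∧
          (((Minberr.minberr b kmax ε δ).exec A TA ω).2 : ℝ) ≤
            C * (k * (TA + n + Real.log (1 / δ)))) ∧
        -- with probability at least `1 - δ`: near-minimal backward error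
        ∃ m : ℝ≥0∞, IsLeast (Minberr.berr A b '' (Minberr.krylov A b k : Set (Fin n → ℝ))) m ∧
          ∀ (Ω : Type*) [MeasurableSpace Ω] (P : Measure Ω) [IsProbabilityMeasure P]
            (g : ℕ → Ω → ℝ),
            (∀ i, HasLaw (g i) (gaussianReal 0 1) P) → iIndepFun g P →
            ∀ TA : ℕ,
              ENNReal.ofReal (1 - δ) ≤
                P {z | Minberr.berr A b
                    ((Minberr.minberr b kmax ε δ).exec A TA fun i => g i z).1.x ≤
                  (1 + 1 / 2) * m} := by
  refine ⟨200, fun n A b hpd hb kmax ε δ hkmax hε hδ0 hδ1 => ?_⟩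
  have hA := Minberr.specNorm_pos hpd hb
  have hsymm : A.IsSymm := by
    have h := hpd.isHermitian
    rwa [Matrix.IsHermitian, Matrix.conjTranspose_eq_transpose_of_trivial] at h
  obtain ⟨k, s, hk1, hk2, hdet, hL, hB, hend⟩ := Minberr.exists_det_mainLoop hsymm kmax
    (Minberr.isLanczos_init (A := A) hb) (Minberr.isBand_init _) (Minberr.isChol_init ε _)
    (by simp [Minberr.initState])
  simp only [zero_add] at hdet hL hB hend
  have hk := hk2 hkmax
  have hkn := hL.le_dim
  refine ⟨k, hk, hk1, ?_⟩
  by_cases hβ : s.β (k + 1) = 0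
  · -- the exact solution lies in the Krylov subspace
    have hd : s.d k = 0 := by rw [hB.d_eq k hk le_rfl, hβ]
    have hzero := hL.berr_nullVec hpd hB hk hb hβ
    have hrun : ∀ TA ω, Minberr.Prog.Runs A TA (Minberr.minberr b kmax ε δ) ω _ _ ω :=
      fun TA ω => Minberr.runs_minberr (hdet TA)
        (Minberr.det_singularVector A TA δ k s hd ω)
    have hmem : (Minberr.comb k s fun j => Minberr.nullVec s.d s.e s.f k j /
        (s.firstRow (Minberr.nullVec s.d s.e s.f k) / Minberr.euclNorm b)) ∈
        Minberr.krylov A b k := (hL.mem_krylov_iff hb _).2 ⟨_, rfl⟩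
    refine ⟨Or.inr ⟨_, hmem, by rw [hzero, mul_zero]; exact zero_le⟩, fun TA ω => ?_, 0,
      ⟨⟨_, hmem, hzero⟩, fun _ _ => zero_le⟩, ?_⟩
    · obtain ⟨h1, h2⟩ := (hrun TA ω).exec_eq
      rw [h1]
      exact ⟨rfl, (Nat.cast_le.2 h2).trans
        (Minberr.cost_le hk hkn hδ0 hδ1 (Or.inr le_rfl))⟩
    · intro Ω _ P _ g _ _ TA
      have huniv : {z | Minberr.berr A b
          ((Minberr.minberr b kmax ε δ).exec A TA fun i => g i z).1.x ≤ (1 + 1 / 2) * 0} =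
          Set.univ := by
        refine Set.eq_univ_of_forall fun z => ?_
        change Minberr.berr A b _ ≤ _
        rw [((hrun TA _).exec_eq).1, hzero]
        exact zero_le
      rw [huniv, measure_univ]
      exact ENNReal.ofReal_le_one.2 (by linarith)
  · have hd : 0 < s.d k := by
      rw [hB.d_eq k hk le_rfl]
      exact hL.nonneg.lt_of_ne' hβ
    obtain ⟨σ, hσ, hmin, hleast, hprob⟩ :=
      hL.le_measure_inverse_iteration hpd hB hk hb hβ hδ0 hδ1
    have hrun : ∀ TA ω, Minberr.Prog.Runs A TA (Minberr.minberr b kmax ε δ) ω _ _ _ :=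
      fun TA ω => Minberr.runs_minberr (hdet TA)
        (Minberr.runs_singularVector A TA δ k s ω hd)
    refine ⟨hend.imp_right ?_, fun TA ω => ?_, _, hleast, ?_⟩
    · rintro ⟨z, hz, hz1, hz2⟩
      obtain ⟨x, hx, hxm⟩ := hleast.1
      refine ⟨x, hx, ?_⟩
      rw [hxm, ← ENNReal.ofReal_mul hA.le, mul_div_cancel₀ _ hA.ne']
      refine ENNReal.ofReal_le_ofReal ?_
      have hpos := Minberr.sqSum_pos hk le_rfl (z := z) (by rw [hz1]; exact one_ne_zero)
      have h3 := hmin z hz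
      rw [← Minberr.norm_vec_sq] at hpos
      rw [← Minberr.norm_vec_sq, ← Minberr.norm_vec_sq, ← mul_pow] at hz2
      have hvp : 0 < ‖Minberr.vec k z‖ :=
        lt_of_le_of_ne (norm_nonneg _) fun h0 => by rw [← h0] at hpos; norm_num at hpos
      exact le_of_mul_le_mul_right (h3.trans (le_of_sq_le_sq hz2 (by positivity))) hvp
    · obtain ⟨h1, h2⟩ := (hrun TA ω).exec_eq
      rw [h1]
      exact ⟨rfl, (Nat.cast_le.2 h2).trans
        (Minberr.cost_le hk hkn hδ0 hδ1 (Or.inl le_rfl))⟩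
    · intro Ω _ P _ g hg hind TA
      refine (hprob Ω P g hg hind).trans (measure_mono fun z hz => ?_)
      change Minberr.berr A b _ ≤ _
      rw [((hrun TA _).exec_eq).1]
      exact hz _ rfl
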